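/- Let $E$ be a complex Banach space, let $n\ge 0$ and $\ell\ge 1$ be integers, and write $\mathbb{Z}^*=\mathbb{Z}\setminus\{0\}$. Let $A$ be a linear operator in $E$ with domain $D(A)$ that generates an $n$-times integrated group $(S(t))_{t\in\mathbb{R}}\subset\mathcal{L}(E)$; that is, $t\mapsto S(t)x$ is continuous on $\mathbb{R}$ for every $x\in E$, and there is $w\in\mathbb{R}$ such that, for all $\lambda\in\mathbb{C}$ with $\operatorname{Re}\lambda>w$, the operators $\lambda-A$ and $\lambda+A$ are invertible with bounded inverses and, for every $x\in E$, $$(\lambda-A)^{-1}x=\lambda^n\int_0^\infty e^{-\lambda t}S(t)x\,dt,\qquad (\lambda+A)^{-1}x=\lambda^n\int_0^\infty e^{-\lambda t}(-1)^nS(-t)x\,dt,$$ with absolutely convergent integrals. Assume that for some constant $M$ $$\|S(t)\|\le M(1+|t|^n)\qquad(t\in\mathbb{R}),$$ and that the spectrum of $A$ is $\sigma(A)=\{i\lambda_k:\ k\in\mathbb{Z}^*\}$, where $(\lambda_k)_{k\in\mathbb{Z}^*}$ is a strictly increasing family of real numbers with $\lambda_k>0$ for $k>0$ and $\lambda_k<0$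 for $k<0$. Let $$\delta_k:=\min\left(\frac{|\lambda_{k^+}-\lambda_k|}{2},\frac{|\lambda_{k^-}-\lambda_k|}{2}\right),$$ where $k^+$ and $k^-$ are the successor and the predecessor of $k$ in $\mathbb{Z}^*$ (so $(-1)^+=1$ and $1^-=-1$), and assume that $$\sum_{k\in\mathbb{Z}^*}\frac{1}{|\lambda_k|^{\ell}\,\delta_k^{\,n}}<\infty .$$ For $k\in\mathbb{Z}^*$ let $P_k$ be the spectral projection $$P_k:=\frac{1}{2i\pi}\int_{|z-i\lambda_k|=\varepsilon_k}(z-A)^{-1}\,dz,$$ the circle being positively oriented and $\varepsilon_k>0$ being any radius such that $\{z:\ |z-i\lambda_k|\le\varepsilon_k\}\cap\sigma(A)=\{i\lambda_k\}$. Then $$\sum_{k\in\mathbb{Z}^*}P_kx=x\qquad\text{for all }x\in D(A^{n+\ell}),$$ the series converging unconditionally in the norm of $E$. -/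

import Mathlib

open scoped Real

noncomputable section

namespace IntegratedGroup

/-! ### Unbounded operators: resolvent, spectrum, domains of powers -/

section Operators

variable {E : Type*} [NormedAddCommGroup E] [NormedSpace ℂ E]

/-- `R` is the bounded two-sided inverse of `z - A : D(A) → E`. Such an `R` is unique. -/
def IsResolventAt (A : E →ₗ.[ℂ] E) (z : ℂ) (R : E →L[ℂ] E) : Prop :=
  (∀ x : E, ∃ h : R x ∈ A.domain, z • R x - A ⟨R x, h⟩ = x) ∧
    ∀ x : A.domain, R (z • (x : E) - A x) = x

theorem IsResolventAt.unique {A : E →ₗ.[ℂ] E} {z : ℂ} {R R' : E →L[ℂ] E}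
    (h : IsResolventAt A z R) (h' : IsResolventAt A z R') : R = R' := by
  ext x
  obtain ⟨hx, e⟩ := h.1 x
  have := h'.2 ⟨R x, hx⟩
  rw [e] at this
  exact this.symm

/-- The resolvent set `ρ(A)`. -/
def resolventSet (A : E →ₗ.[ℂ] E) : Set ℂ :=
  {z | ∃ R : E →L[ℂ] E, IsResolventAt A z R}

/-- The spectrum `σ(A)`. -/
def spectrum (A : E →ₗ.[ℂ] E) : Set ℂ :=
  (resolventSet A)ᶜ

open Classical in
/-- The resolvent `R(z, A) = (z - A)⁻¹` for `z ∈ ρ(A)` (and `0` for `z ∈ σ(A)`). -/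
def resolvent (A : E →ₗ.[ℂ] E) (z : ℂ) : E →L[ℂ] E :=
  if h : ∃ R : E →L[ℂ] E, IsResolventAt A z R then h.choose else 0

theorem resolvent_spec {A : E →ₗ.[ℂ] E} {z : ℂ} (hz : z ∈ resolventSet A) :
    IsResolventAt A z (resolvent A z) := by
  have h : ∃ R : E →L[ℂ] E, IsResolventAt A z R := hz
  rw [resolvent, dif_pos h]
  exact h.choose_spec

/-- The domain `D(A ^ m)`: `D(A ^ 0) = E` and
`D(A ^ (m + 1)) = {x ∈ D(A) | A x ∈ D(A ^ m)}`. -/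
def powDomain (A : E →ₗ.[ℂ] E) : ℕ → Set E
  | 0 => Set.univ
  | m + 1 => {x | ∃ h : x ∈ A.domain, A ⟨x, h⟩ ∈ powDomain A m}

/-- The Riesz integral `(2πi)⁻¹ ∮ R(z, A) dz` over the positively oriented circle of centre `c`
and radius `r`, as a bounded operator. -/
def rieszProjection (A : E →ₗ.[ℂ] E) (c : ℂ) (r : ℝ) : E →L[ℂ] E :=
  (2 * (π : ℂ) * Complex.I)⁻¹ • ∮ z in C(c, r), resolvent A z

/-- `A` generates the `n`-times integrated semigroup `(S t)_{t ≥ 0}`: the family is strongly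
continuous on `[0, ∞)` and, for some real `w`,
`(z - A)⁻¹ = z ^ n ∫_0^∞ e^{-z t} S(t) dt` (strongly) whenever `Re z > w`. -/
def GeneratesIntegratedSemigroup (n : ℕ) (A : E →ₗ.[ℂ] E) (S : ℝ → E →L[ℂ] E) : Prop :=
  (∀ x : E, ContinuousOn (fun t => S t x) (Set.Ici 0)) ∧
    ∃ w : ℝ, ∀ z : ℂ, w < z.re →
      z ∈ resolventSet A ∧
        ∀ x : E,
          MeasureTheory.IntegrableOn (fun t : ℝ => Complex.exp (-z * t) • S t x) (Set.Ioi 0) ∧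
            resolvent A z x = z ^ n • ∫ t in Set.Ioi (0 : ℝ), Complex.exp (-z * t) • S t x

/-- `A` generates the `n`-times integrated group `(S t)_{t ∈ ℝ}`: `A` generates the `n`-times
integrated semigroup `(S t)_{t ≥ 0}` and `-A` generates `((-1) ^ n S(-t))_{t ≥ 0}`. The sign is
the one of the `n`-fold integral `∫_0^t (t - s)^(n - 1) / (n - 1)! e^{s A} ds`. -/
def GeneratesIntegratedGroup (n : ℕ) (A : E →ₗ.[ℂ] E) (S : ℝ → E →L[ℂ] E) : Prop :=
  GeneratesIntegratedSemigroup n A S ∧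
    GeneratesIntegratedSemigroup n (-A) (fun t => (-1 : ℂ) ^ n • S (-t))

end Operators

/-! ### Sequences indexed by the nonzero integers -/

/-- The index set `ℤ* = ℤ \ {0}`, with the order of `ℤ`. -/
abbrev NZInt : Type := {k : ℤ // k ≠ 0}

/-- The successor of `k` in `ℤ*`; the successor of `-1` is `1`. -/
def NZInt.next (k : NZInt) : NZInt :=
  if h : k.1 + 1 = 0 then ⟨1, one_ne_zero⟩ else ⟨k.1 + 1, h⟩

/-- The predecessor of `k` in `ℤ*`; the predecessor of `1` is `-1`. -/
def NZInt.prev (k : NZInt) : NZInt :=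
  if h : k.1 - 1 = 0 then ⟨-1, by decide⟩ else ⟨k.1 - 1, h⟩

/-- `δ_k`: half the distance from `lam k` to the nearer of its two neighbours. -/
def halfGap (lam : NZInt → ℝ) (k : NZInt) : ℝ :=
  min (|lam k.next - lam k| / 2) (|lam k.prev - lam k| / 2)

end IntegratedGroup

end

noncomputable section

namespace IntegratedGroup

/-! ### Resolvent identities and holomorphy for an unbounded operator. -/

section Resolvent

variable {E : Type*} [NormedAddCommGroup E] [NormedSpace ℂ E] {A : E →ₗ.[ℂ] E} {z w : ℂ}

/-! Write `R(z) = (z - A)⁻¹`. The Laplace formula and the growth of `S` give `‖R(z)‖ ≤ M |z|^n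
(1/|Re z| + n!/|Re z|^(n+1))` off the imaginary axis. The theorem splits into completeness and
convergence.

Completeness (`GeneratesIntegratedGroup.eq_zero_of_rieszProjection_eq_zero`): if every `P_k v`
vanishes, then `z ↦ R(z) v` extends to an entire function. A weighted maximum principle carries the
bound across the imaginary axis, so the growth is polynomial, and a Liouville argument gives `v =
0`. Since the `P_k` are idempotent and annihilate one another, a convergent series `∑ P_k x = x'`
satisfies `P_j (x - x') = 0` for all `j`, hence `x' = x`.

Convergence (`GeneratesIntegratedGroup.summable_rieszProjection`): write `x = R(2)^(n+l) y`. Then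
`P_k x` is a contour integral of `(2 - w)^(-(n+l)) R(w) y`; `n` of the scalar factors cancel the
growth `|z|^n` and the others leave `|λ_k|^(-l)`. On a circle of radius `r/2` with `r ≤ min(1, δ_k)`
the resolvent costs `r^(-(n+1))` and the length of the circle gives back one power. If `δ_k < 1`,
the choice `r = δ_k` yields exactly the terms of the summable hypothesis.

If `δ_k ≥ 1`, only `|λ_k|^(-l)` is left, whose summability the hypothesis does not provide. These
frequencies are separated, so their projections are summed before taking norms
(`GeneratesIntegratedGroup.norm_sum_rieszProjection_le`). After translating all circles to the
origin, the integrand is the integral of `S(t) y` against a damped exponential sum, whose weighted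
`L²` norm is controlled by the `ℓ²` norm of its coefficients (`integral_exp_mul_norm_expSum_sq_le`).
Thus `∑ |λ_k|^(-2l) < ∞` suffices, and this holds for separated frequencies. -/

theorem IsResolventAt.resolvent_eq {R : E →L[ℂ] E} (h : IsResolventAt A z R) :
    resolvent A z = R :=
  (resolvent_spec ⟨R, h⟩).unique h

theorem resolvent_sub_apply (hz : z ∈ resolventSet A) (hw : w ∈ resolventSet A) (x : E) :
    resolvent A z x - resolvent A w x = (w - z) • resolvent A z (resolvent A w x) := by
  obtain ⟨hd, e⟩ := (resolvent_spec hw).1 x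
  have h2 := (resolvent_spec hz).2 ⟨resolvent A w x, hd⟩
  have h3 : x = (w - z) • resolvent A w x
      + (z • resolvent A w x - A ⟨resolvent A w x, hd⟩) := by
    rw [sub_smul]
    nth_rewrite 1 [← e]
    abel
  have h4 : resolvent A z x = (w - z) • resolvent A z (resolvent A w x) + resolvent A w x := by
    nth_rewrite 1 [h3]
    rw [map_add, map_smul]
    simp only at h2
    rw [h2]
  rw [h4]
  abel

theorem resolvent_comm (hz : z ∈ resolventSet A) (hw : w ∈ resolventSet A) (x : E) :
    resolvent A z (resolvent A w x) = resolvent A w (resolvent A z x) := by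
  rcases eq_or_ne z w with rfl | hne
  · rfl
  have h1 := resolvent_sub_apply hz hw x
  have h2 := resolvent_sub_apply hw hz x
  have h3 : (w - z) • resolvent A z (resolvent A w x)
      = (w - z) • resolvent A w (resolvent A z x) := by
    rw [← h1, ← neg_sub (resolvent A w x), h2, ← neg_smul, neg_sub]
  exact smul_right_injective E (sub_ne_zero.2 hne.symm) h3

theorem eq_zero_of_resolvent_eq_zero (hz : z ∈ resolventSet A) {x : E}
    (hx : resolvent A z x = 0) : x = 0 := by
  obtain ⟨hd, e⟩ := (resolvent_spec hz).1 x
  have : (⟨resolvent A z x, hd⟩ : A.domain) = 0 := Subtype.ext hx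
  rw [this, hx] at e
  simpa using e.symm

/-- On the domain, `w - A = (1 + (w - z) R)(z - A)`, so it is enough to invert the bounded factor.
That factor commutes with `R`, which makes the candidate a two-sided inverse. -/
theorem IsResolventAt.perturb {R : E →L[ℂ] E} (h : IsResolventAt A z R)
    (hu : IsUnit (1 + (w - z) • R)) :
    IsResolventAt A w (R * Ring.inverse (1 + (w - z) • R)) := by
  obtain ⟨u, hu⟩ := hu
  have hcomm : R * (u : E →L[ℂ] E) = (u : E →L[ℂ] E) * R := by
    rw [hu, mul_add, add_mul, mul_one, one_mul, mul_smul_comm, smul_mul_assoc]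
  have hcomm' : R * (↑u⁻¹ : E →L[ℂ] E) = (↑u⁻¹ : E →L[ℂ] E) * R := by
    have := congrArg (fun X => (↑u⁻¹ : E →L[ℂ] E) * X * (↑u⁻¹ : E →L[ℂ] E)) hcomm
    simpa [mul_assoc] using this.symm
  rw [← hu, Ring.inverse_unit]
  constructor
  · intro x
    obtain ⟨hd, e⟩ := h.1 ((↑u⁻¹ : E →L[ℂ] E) x)
    refine ⟨hd, ?_⟩
    have h1 : (u : E →L[ℂ] E) ((↑u⁻¹ : E →L[ℂ] E) x) = x := by
      rw [← mul_apply_eq_comp, u.mul_inv]; rfl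
    rw [hu] at h1
    simp only [add_apply, one_apply_eq_self,
      smul_apply] at h1
    set y := (↑u⁻¹ : E →L[ℂ] E) x
    change w • R y - A ⟨R y, hd⟩ = x
    have h5 : w • R y - A ⟨R y, hd⟩ = (z • R y - A ⟨R y, hd⟩) + (w - z) • R y := by
      rw [sub_smul]; abel
    rw [h5, e, h1]
  · intro x
    rw [hcomm']
    change (↑u⁻¹ : E →L[ℂ] E) (R (w • (x : E) - A x)) = x
    have h5 : w • (x : E) - A x = (z • (x : E) - A x) + (w - z) • (x : E) := by
      rw [sub_smul]; abel
    have h6 : R (w • (x : E) - A x) = (u : E →L[ℂ] E) x := by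
      rw [h5, map_add, h.2 x, map_smul, hu]
      simp
    rw [h6, ← mul_apply_eq_comp, u.inv_mul]; rfl

theorem eventually_isUnit_one_add_smul [CompleteSpace E] (R : E →L[ℂ] E) (z : ℂ) :
    ∀ᶠ w in nhds z, IsUnit (1 + (w - z) • R) := by
  have hc : Continuous fun w : ℂ => 1 + (w - z) • R := by fun_prop
  have ho : IsOpen {X : E →L[ℂ] E | IsUnit X} := Units.isOpen
  exact hc.continuousAt.eventually (ho.mem_nhds (by simp))

theorem isOpen_resolventSet [CompleteSpace E] (A : E →ₗ.[ℂ] E) : IsOpen (resolventSet A) := by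
  rw [isOpen_iff_mem_nhds]
  rintro z ⟨R, hR⟩
  filter_upwards [eventually_isUnit_one_add_smul R z] with w hw
  exact ⟨_, hR.perturb hw⟩

theorem differentiableAt_resolvent [CompleteSpace E] (hz : z ∈ resolventSet A) :
    DifferentiableAt ℂ (resolvent A) z := by
  have h := resolvent_spec hz
  have hd : DifferentiableAt ℂ
      (fun w => resolvent A z * Ring.inverse (1 + (w - z) • resolvent A z)) z := by
    refine (differentiableAt_const _).mul ?_
    refine DifferentiableAt.comp (g := Ring.inverse) z ?_ (by fun_prop)
    have h1 : (1 + (z - z) • resolvent A z) = ((1 : (E →L[ℂ] E)ˣ) : E →L[ℂ] E) := by simp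
    rw [h1]
    exact differentiableAt_inverse (isUnit_one)
  refine hd.congr_of_eventuallyEq ?_
  filter_upwards [eventually_isUnit_one_add_smul (resolvent A z) z] with w hw
  exact (h.perturb hw).resolvent_eq

theorem differentiableAt_resolvent_apply [CompleteSpace E] (hz : z ∈ resolventSet A) (x : E) :
    DifferentiableAt ℂ (fun w => resolvent A w x) z :=
  (differentiableAt_resolvent hz).clm_apply (differentiableAt_const x)

theorem IsResolventAt.neg {R : E →L[ℂ] E} (h : IsResolventAt A z R) :
    IsResolventAt (-A) (-z) (-R) := by
  constructor
  · intro x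
    obtain ⟨hd, e⟩ := h.1 x
    have hd' : (-R) x ∈ (-A).domain := by
      simpa [LinearPMap.neg_domain] using hd
    refine ⟨hd', ?_⟩
    have : (⟨(-R) x, hd'⟩ : (-A).domain) = -(⟨R x, hd⟩ : A.domain) := Subtype.ext rfl
    rw [LinearPMap.neg_apply]
    have h2 : A ⟨(-R) x, hd'⟩ = - A ⟨R x, hd⟩ := by
      rw [← LinearPMap.map_neg]; exact congrArg A this
    rw [h2]
    simpa using e
  · intro x
    have h2 := h.2 x
    rw [LinearPMap.neg_apply]
    rw [neg_apply, ← map_neg]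
    rw [show -(-z • (x : E) - -(A x)) = z • (x : E) - A x by rw [neg_smul]; abel]
    exact h2

theorem neg_mem_resolventSet_neg (hz : z ∈ resolventSet A) : -z ∈ resolventSet (-A) :=
  ⟨_, (resolvent_spec hz).neg⟩

theorem resolvent_neg_neg (hz : z ∈ resolventSet A) : resolvent (-A) (-z) = -resolvent A z :=
  (resolvent_spec hz).neg.resolvent_eq

/-- One factor is peeled off at a time: `x = R(z)(z x - A x)`, and `z x - A x` loses only one degree
of regularity. -/
theorem exists_resolvent_pow_apply_eq (hz : z ∈ resolventSet A) (m : ℕ) :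
    ∀ x ∈ powDomain A m, ∃ y, (resolvent A z ^ m) y = x := by
  induction m with
  | zero => exact fun x _ => ⟨x, by simp⟩
  | succ m ih =>
    have hmem : ∀ (k : ℕ) (x : E), x ∈ powDomain A (k + 1) → x ∈ powDomain A k := by
      intro k
      induction k with
      | zero => exact fun _ _ => trivial
      | succ k ihk => exact fun x ⟨h, h'⟩ => ⟨h, ihk _ h'⟩
    have hadd : ∀ (k : ℕ) (x y : E), x ∈ powDomain A k → y ∈ powDomain A k →
        ∀ c : ℂ, c • x - y ∈ powDomain A k := by
      intro k
      induction k with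
      | zero => exact fun _ _ _ _ _ => trivial
      | succ k ihk =>
        rintro x y ⟨hx, hx'⟩ ⟨hy, hy'⟩ c
        refine ⟨A.domain.sub_mem (A.domain.smul_mem c hx) hy, ?_⟩
        have : A ⟨c • x - y, A.domain.sub_mem (A.domain.smul_mem c hx) hy⟩
            = c • A ⟨x, hx⟩ - A ⟨y, hy⟩ := by
          rw [← LinearPMap.map_smul, ← LinearPMap.map_sub]; rfl
        rw [this]
        exact ihk _ _ hx' hy' c
    rintro x hx
    obtain ⟨hd, hd'⟩ := hx
    obtain ⟨y, hy⟩ := ih (z • x - A ⟨x, hd⟩) (hadd m _ _ (hmem m x ⟨hd, hd'⟩) hd' z)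
    refine ⟨y, ?_⟩
    rw [pow_succ', mul_apply_eq_comp, hy]
    exact (resolvent_spec hz).2 ⟨x, hd⟩

/-- Iterating the resolvent identity trades each factor `R(z₀)` for a scalar `(z₀ - w)⁻¹`, up to a
term holomorphic away from `z₀`. Such a term disappears in any contour integral that does not
enclose `z₀`. -/
theorem exists_resolvent_resolvent_pow_eq {z₀ : ℂ} (h₀ : z₀ ∈ resolventSet A) (y : E) (m : ℕ) :
    ∃ h : ℂ → E, (∀ w, w ≠ z₀ → DifferentiableAt ℂ h w) ∧ ∀ w ∈ resolventSet A, w ≠ z₀ →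
      resolvent A w ((resolvent A z₀ ^ m) y) = ((z₀ - w)⁻¹ ^ m) • resolvent A w y + h w := by
  induction m with
  | zero => exact ⟨fun _ => 0, fun _ _ => differentiableAt_const _, fun w _ _ => by simp⟩
  | succ m ih =>
    obtain ⟨h, hd, hh⟩ := ih
    refine ⟨fun w => resolvent A z₀ (h w) - ((z₀ - w)⁻¹ ^ (m + 1)) • resolvent A z₀ y,
      fun w hw => ?_, fun w hw hne => ?_⟩
    · refine ((resolvent A z₀).differentiableAt.comp w (hd w hw)).sub ?_
      refine DifferentiableAt.smul_const ?_ _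
      exact (((differentiableAt_const z₀).sub differentiableAt_id).inv
        (sub_ne_zero.2 hw.symm)).pow _
    · rw [pow_succ', mul_apply_eq_comp, resolvent_comm hw h₀, hh w hw hne, map_add, map_smul,
        ← resolvent_comm hw h₀]
      have h1 := resolvent_sub_apply hw h₀ y
      have h2 : resolvent A w (resolvent A z₀ y)
          = (z₀ - w)⁻¹ • (resolvent A w y - resolvent A z₀ y) := by
        rw [h1, smul_smul, inv_mul_cancel₀ (sub_ne_zero.2 hne.symm), one_smul]
      rw [h2, smul_smul, ← pow_succ, smul_sub, sub_add_eq_add_sub, add_sub_assoc]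

end Resolvent

/-! ### Laplace transforms and resolvent bounds in the right half-plane. -/

section Laplace

open MeasureTheory Set

theorem integrableOn_pow_mul_exp_neg (k : ℕ) {b : ℝ} (hb : 0 < b) :
    IntegrableOn (fun t : ℝ => t ^ k * Real.exp (-(b * t))) (Ioi 0) := by
  have h := integrableOn_rpow_mul_exp_neg_mul_rpow (p := 1) (s := k) (b := b)
    (by have : (0 : ℝ) ≤ k := k.cast_nonneg
        linarith) one_pos hb
  simpa using h

theorem integral_pow_mul_exp_neg (k : ℕ) {b : ℝ} (hb : 0 < b) :
    ∫ t in Ioi (0 : ℝ), t ^ k * Real.exp (-(b * t)) = k.factorial / b ^ (k + 1) := by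
  have h := Real.integral_rpow_mul_exp_neg_mul_Ioi (a := k + 1) (r := b) (by positivity) hb
  rw [Real.Gamma_nat_eq_factorial] at h
  have h2 : (1 / b) ^ ((k : ℝ) + 1) = (b ^ (k + 1))⁻¹ := by
    rw [one_div, show (k : ℝ) + 1 = ((k + 1 : ℕ) : ℝ) by push_cast; ring, Real.rpow_natCast,
      inv_pow]
  rw [h2] at h
  simp only [add_sub_cancel_right, Real.rpow_natCast] at h
  rw [h]
  ring

variable {E : Type*} [NormedAddCommGroup E] [NormedSpace ℂ E]

theorem norm_exp_neg_mul (z : ℂ) (t : ℝ) :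
    ‖Complex.exp (-z * t)‖ = Real.exp (-(z.re * t)) := by
  rw [Complex.norm_exp]
  simp

theorem aestronglyMeasurable_exp_smul {φ : ℝ → E} (hc : ContinuousOn φ (Ici 0)) {g : ℝ → ℂ}
    (hg : Continuous g) :
    AEStronglyMeasurable (fun t => g t • φ t) (volume.restrict (Ioi 0)) :=
  ((hg.continuousOn.smul (hc.mono Ioi_subset_Ici_self)).aestronglyMeasurable measurableSet_Ioi)

theorem integrableOn_exp_smul {φ : ℝ → E} (hc : ContinuousOn φ (Ici 0)) {n : ℕ} {K : ℝ}
    (hK : ∀ t, 0 ≤ t → ‖φ t‖ ≤ K * (1 + t ^ n)) {z : ℂ} (hz : 0 < z.re) :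
    IntegrableOn (fun t : ℝ => Complex.exp (-z * t) • φ t) (Ioi 0) := by
  have hi : IntegrableOn (fun t : ℝ => K * (t ^ 0 * Real.exp (-(z.re * t))
      + t ^ n * Real.exp (-(z.re * t)))) (Ioi 0) :=
    ((integrableOn_pow_mul_exp_neg 0 hz).add (integrableOn_pow_mul_exp_neg n hz)).const_mul K
  refine Integrable.mono' hi (aestronglyMeasurable_exp_smul hc (by fun_prop)) ?_
  refine (ae_restrict_iff' measurableSet_Ioi).2 (Filter.Eventually.of_forall fun t ht => ?_)
  rw [norm_smul, norm_exp_neg_mul]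
  calc _ ≤ Real.exp (-(z.re * t)) * (K * (1 + t ^ n)) := by
        gcongr
        exact hK t (le_of_lt ht)
    _ = _ := by ring

theorem differentiableAt_laplace {φ : ℝ → E} (hc : ContinuousOn φ (Ici 0)) {n : ℕ}
    {K : ℝ} (hK : ∀ t, 0 ≤ t → ‖φ t‖ ≤ K * (1 + t ^ n)) {z : ℂ} (hz : 0 < z.re) :
    DifferentiableAt ℂ (fun z : ℂ => ∫ t in Ioi (0 : ℝ), Complex.exp (-z * t) • φ t) z := by
  have hb : 0 < z.re / 2 := by positivity
  have hi : IntegrableOn (fun t : ℝ => K * (t ^ 1 * Real.exp (-(z.re / 2 * t))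
      + t ^ (n + 1) * Real.exp (-(z.re / 2 * t)))) (Ioi 0) :=
    ((integrableOn_pow_mul_exp_neg 1 hb).add (integrableOn_pow_mul_exp_neg (n + 1) hb)).const_mul K
  have hmem : {u : ℂ | z.re / 2 < u.re} ∈ nhds z :=
    (isOpen_lt continuous_const Complex.continuous_re).mem_nhds (by simp; linarith)
  refine (hasDerivAt_integral_of_dominated_loc_of_deriv_le
    (F := fun (z : ℂ) (t : ℝ) => Complex.exp (-z * t) • φ t)
    (F' := fun (z : ℂ) (t : ℝ) => (Complex.exp (-z * t) * (-t)) • φ t) hmem ?_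
    (integrableOn_exp_smul hc hK hz) ?_ ?_ hi ?_).2.differentiableAt
  · exact Filter.Eventually.of_forall fun u => aestronglyMeasurable_exp_smul hc (by fun_prop)
  · exact aestronglyMeasurable_exp_smul hc (by fun_prop)
  · refine (ae_restrict_iff' measurableSet_Ioi).2 (Filter.Eventually.of_forall fun t ht u hu => ?_)
    have ht : 0 < t := ht
    have hu : z.re / 2 < u.re := hu
    have h0 : 0 ≤ K * (1 + t ^ n) := (norm_nonneg _).trans (hK t ht.le)
    rw [norm_smul, norm_mul, norm_exp_neg_mul, norm_neg, Complex.norm_real, Real.norm_eq_abs,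
      abs_of_pos ht]
    calc _ ≤ Real.exp (-(z.re / 2 * t)) * t * (K * (1 + t ^ n)) := by
          gcongr
          exact hK t ht.le
      _ = _ := by ring
  · refine Filter.Eventually.of_forall fun t u _ => ?_
    have h1 : HasDerivAt (fun u : ℂ => -u * (t : ℂ)) (-t) u := by
      simpa using ((hasDerivAt_id u).neg.mul_const (t : ℂ))
    exact h1.cexp.smul_const (φ t)

variable {n : ℕ} {A : E →ₗ.[ℂ] E} {S : ℝ → E →L[ℂ] E} {M : ℝ}

theorem norm_apply_le_of_norm_le (hM : ∀ t, 0 ≤ t → ‖S t‖ ≤ M * (1 + t ^ n)) (x : E) (t : ℝ)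
    (ht : 0 ≤ t) : ‖S t x‖ ≤ M * ‖x‖ * (1 + t ^ n) :=
  calc ‖S t x‖ ≤ ‖S t‖ * ‖x‖ := (S t).le_opNorm x
    _ ≤ M * (1 + t ^ n) * ‖x‖ := by gcongr; exact hM t ht
    _ = _ := by ring

variable [CompleteSpace E]

/-- The Laplace representation of the resolvent extends to the whole right half-plane. -/
theorem GeneratesIntegratedSemigroup.resolvent_eq_laplace
    (hS : GeneratesIntegratedSemigroup n A S) (hM : ∀ t, 0 ≤ t → ‖S t‖ ≤ M * (1 + t ^ n))
    (hρ : ∀ z : ℂ, 0 < z.re → z ∈ resolventSet A) {z : ℂ} (hz : 0 < z.re) (x : E) :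
    resolvent A z x = z ^ n • ∫ t in Ioi (0 : ℝ), Complex.exp (-z * t) • S t x := by
  obtain ⟨hc, w, hw⟩ := hS
  set U : Set ℂ := {z | 0 < z.re}
  have hUo : IsOpen U := isOpen_lt continuous_const Complex.continuous_re
  have h1 : AnalyticOnNhd ℂ (fun z => resolvent A z x) U := by
    refine DifferentiableOn.analyticOnNhd (fun z hz => ?_) hUo
    exact (differentiableAt_resolvent_apply (hρ z hz) x).differentiableWithinAt
  have h2 : AnalyticOnNhd ℂ
      (fun z => z ^ n • ∫ t in Ioi (0 : ℝ), Complex.exp (-z * t) • S t x) U := by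
    refine DifferentiableOn.analyticOnNhd (fun z hz => ?_) hUo
    refine DifferentiableAt.differentiableWithinAt ?_
    exact (differentiableAt_pow n).smul
      (differentiableAt_laplace (hc x) (norm_apply_le_of_norm_le hM x) hz)
  have hpc : IsPreconnected U := (convex_halfSpace_re_gt 0).isPreconnected
  -- A point to the right of both `0` and `w`: the representation holds near it by definition, and
  -- the identity theorem spreads it over the half-plane.
  set z₀ : ℂ := ((max w 0 + 1 : ℝ) : ℂ)
  have hz₀ : z₀ ∈ U := by
    simp only [U, z₀, mem_ofPred_eq, Complex.ofReal_re]
    positivity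
  refine h1.eqOn_of_preconnected_of_eventuallyEq h2 hpc hz₀ ?_ hz
  have hmem : {u : ℂ | w < u.re} ∈ nhds z₀ :=
    (isOpen_lt continuous_const Complex.continuous_re).mem_nhds (by
      simp only [z₀, mem_ofPred_eq, Complex.ofReal_re]
      linarith [le_max_left w 0])
  filter_upwards [hmem] with u hu
  exact ((hw u hu).2 x).2

theorem GeneratesIntegratedSemigroup.norm_resolvent_le
    (hS : GeneratesIntegratedSemigroup n A S) (hM : ∀ t, 0 ≤ t → ‖S t‖ ≤ M * (1 + t ^ n))
    (hρ : ∀ z : ℂ, 0 < z.re → z ∈ resolventSet A) {z : ℂ} (hz : 0 < z.re) (x : E) :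
    ‖resolvent A z x‖
      ≤ M * ‖z‖ ^ n * (1 / z.re + n.factorial / z.re ^ (n + 1)) * ‖x‖ := by
  rw [hS.resolvent_eq_laplace hM hρ hz, norm_smul, norm_pow]
  have hi : IntegrableOn (fun t : ℝ => M * ‖x‖ * (t ^ 0 * Real.exp (-(z.re * t))
      + t ^ n * Real.exp (-(z.re * t)))) (Ioi 0) :=
    ((integrableOn_pow_mul_exp_neg 0 hz).add (integrableOn_pow_mul_exp_neg n hz)).const_mul _
  have h2 : ‖∫ t in Ioi (0 : ℝ), Complex.exp (-z * t) • S t x‖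
      ≤ ∫ t in Ioi (0 : ℝ), M * ‖x‖ * (t ^ 0 * Real.exp (-(z.re * t))
      + t ^ n * Real.exp (-(z.re * t))) := by
    refine norm_integral_le_of_norm_le hi ?_
    refine (ae_restrict_iff' measurableSet_Ioi).2 (Filter.Eventually.of_forall fun t ht => ?_)
    rw [norm_smul, norm_exp_neg_mul]
    calc _ ≤ Real.exp (-(z.re * t)) * (M * ‖x‖ * (1 + t ^ n)) := by
          gcongr
          exact norm_apply_le_of_norm_le hM x t (le_of_lt ht)
      _ = _ := by ring
  rw [integral_const_mul, integral_add (integrableOn_pow_mul_exp_neg 0 hz)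
    (integrableOn_pow_mul_exp_neg n hz), integral_pow_mul_exp_neg _ hz,
    integral_pow_mul_exp_neg _ hz] at h2
  refine (mul_le_mul_of_nonneg_left h2 (by positivity)).trans_eq ?_
  simp
  ring

end Laplace

/-! ### Maximum principle with a weight vanishing where the axis meets the circle. -/

section MaximumPrinciple

open Metric Set

variable {E : Type*} [NormedAddCommGroup E] [NormedSpace ℂ E]

/-- On the circle `s² = ξ · conj ξ`, so `ξ² + s² = 2 ξ Re ξ`: a holomorphic weight whose modulus is
proportional to `|Re ξ|`. -/
theorem norm_sq_add_sq_of_norm_eq {ξ : ℂ} {s : ℝ} (h : ‖ξ‖ = s) :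
    ‖ξ ^ 2 + (s : ℂ) ^ 2‖ = 2 * s * |ξ.re| := by
  have hs : (s : ℂ) ^ 2 = ξ * (starRingEnd ℂ) ξ := by
    rw [Complex.mul_conj, Complex.normSq_eq_norm_sq, h]
    push_cast
    rfl
  have h2 : ξ ^ 2 + (s : ℂ) ^ 2 = ξ * ((2 * ξ.re : ℝ) : ℂ) := by
    rw [hs, ← Complex.add_conj]
    ring
  rw [h2, norm_mul, h, Complex.norm_real, Real.norm_eq_abs, abs_mul, abs_two]
  ring

/-- A holomorphic function on a disc which blows up on the boundary at most like
`|Re (z - c)| ^ (-N)` is controlled inside. -/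
theorem norm_le_of_norm_mul_re_pow_le {f : ℂ → E} {c : ℂ} {s B : ℝ} {N : ℕ} (hN : N ≠ 0)
    (hs : 0 < s) (hf : DiffContOnCl ℂ f (ball c s))
    (hB0 : 0 ≤ B)
    (hB : ∀ z ∈ sphere c s, (z - c).re ≠ 0 → ‖f z‖ * |(z - c).re| ^ N ≤ B)
    {z : ℂ} (hz : z ∈ closedBall c s) :
    ‖f z‖ * (s ^ 2 - ‖z - c‖ ^ 2) ^ N ≤ B * (2 * s) ^ N := by
  -- The weight absorbs the blow-up on the circle. At the two points with `Re (z - c) = 0` it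
  -- vanishes because `N ≠ 0`, so no bound on `f` is needed there.
  have hg : DiffContOnCl ℂ (fun z => ((z - c) ^ 2 + (s : ℂ) ^ 2) ^ N • f z) (ball c s) :=
    DiffContOnCl.smul (Differentiable.diffContOnCl (by fun_prop)) hf
  have hmax := Complex.norm_le_of_forall_mem_frontier_norm_le (C := B * (2 * s) ^ N)
    isBounded_ball hg ?_ (z := z) (by rwa [closure_ball c hs.ne'])
  · refine le_trans ?_ hmax
    rw [norm_smul, norm_pow, mul_comm]
    have hzs : ‖z - c‖ ≤ s := by simpa [dist_eq_norm] using hz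
    have h0 : 0 ≤ s ^ 2 - ‖z - c‖ ^ 2 := by nlinarith [norm_nonneg (z - c)]
    gcongr
    have h1 := norm_sub_le_norm_add ((s : ℂ) ^ 2) ((z - c) ^ 2)
    rw [norm_pow, norm_pow, Complex.norm_real, Real.norm_eq_abs, abs_of_pos hs, add_comm] at h1
    exact h1
  · intro u hu
    rw [frontier_ball c hs.ne'] at hu
    have hus : ‖u - c‖ = s := by simpa [dist_eq_norm] using hu
    rw [norm_smul, norm_pow, norm_sq_add_sq_of_norm_eq hus]
    rcases eq_or_ne (u - c).re 0 with h0 | h0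
    · rw [h0]
      simp only [abs_zero, mul_zero, zero_pow hN, zero_mul]
      positivity
    · have := hB u hu h0
      calc _ = (2 * s) ^ N * (‖f u‖ * |(u - c).re| ^ N) := by rw [mul_pow]; ring
        _ ≤ (2 * s) ^ N * B := by gcongr
        _ = _ := by ring

/-- Uniform bound on a circle around an isolated singularity for a holomorphic function which
blows up near the imaginary axis at most like `|Re z| ^ (-N)`. -/
theorem norm_le_on_sphere_of_norm_mul_re_pow_le {f : ℂ → E} {ρ B : ℝ} {N : ℕ} (hN : N ≠ 0)
    (hρ : 0 < ρ) (hf : ∀ z ∈ ball (0 : ℂ) (2 * ρ), z ≠ 0 → DifferentiableAt ℂ f z)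
    (hB0 : 0 ≤ B)
    (hB : ∀ z ∈ ball (0 : ℂ) (2 * ρ), z.re ≠ 0 → ‖f z‖ * |z.re| ^ N ≤ B)
    {z : ℂ} (hz : ‖z‖ = ρ) : ‖f z‖ ≤ B * (5 / ρ) ^ N := by
  by_cases h : ρ / 2 ≤ |z.re|
  · have hz0 : z.re ≠ 0 := by
      intro h0
      rw [h0, abs_zero] at h
      linarith
    have h1 := hB z (by simp [hz]; linarith) hz0
    have h2 : 0 < |z.re| ^ N := pow_pos (abs_pos.2 hz0) N
    calc ‖f z‖ ≤ B / |z.re| ^ N := by rwa [le_div_iff₀ h2]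
      _ = B * (1 / |z.re|) ^ N := by rw [div_pow, one_pow]; ring
      _ ≤ B * (5 / ρ) ^ N := by
        refine mul_le_mul_of_nonneg_left (pow_le_pow_left₀ (by positivity) ?_ _) hB0
        rw [div_le_div_iff₀ (abs_pos.2 hz0) hρ]
        linarith
  -- Near the axis the singularity at `0` is far away: `|Re z| < ρ/2` forces `|Im z| > 3ρ/4`. The
  -- disc of radius `3ρ/4` about `i Im z` thus avoids `0`, stays in the disc of radius `2ρ`, and
  -- gives the constant `(3/2)/(5/16) = 4.8 ≤ 5`.
  · push Not at h
    set c : ℂ := (z.im : ℂ) * Complex.I with hc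
    have hcre : c.re = 0 := by simp [hc]
    have hcn : ‖c‖ = |z.im| := by simp [hc]
    have hzc : z - c = (z.re : ℂ) := by
      apply Complex.ext <;> simp [hc]
    have hsq : z.re ^ 2 + z.im ^ 2 = ρ ^ 2 := by
      rw [← hz, Complex.sq_norm, Complex.normSq_apply]; ring
    have him : |z.im| ≤ ρ := hz ▸ Complex.abs_im_le_norm z
    have hre2 : z.re ^ 2 < (ρ / 2) ^ 2 := by
      rw [← sq_abs]
      exact pow_lt_pow_left₀ h (abs_nonneg _) two_ne_zero
    have him2 : 3 / 4 * ρ < |z.im| := by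
      apply lt_of_pow_lt_pow_left₀ 2 (abs_nonneg _)
      rw [sq_abs]
      nlinarith
    have hsub : ∀ u ∈ closedBall c (3 / 4 * ρ), u ∈ ball (0 : ℂ) (2 * ρ) ∧ u ≠ 0 := by
      intro u hu
      have hu : ‖u - c‖ ≤ 3 / 4 * ρ := by simpa [dist_eq_norm] using hu
      constructor
      · have := norm_add_le (u - c) c
        rw [sub_add_cancel, hcn] at this
        simp
        linarith
      · rintro rfl
        rw [zero_sub, norm_neg, hcn] at hu
        linarith
    have hs : 0 < 3 / 4 * ρ := by positivity
    have hd : DiffContOnCl ℂ f (ball c (3 / 4 * ρ)) := by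
      refine DifferentiableOn.diffContOnCl fun u hu => ?_
      rw [closure_ball c hs.ne'] at hu
      exact (hf u (hsub u hu).1 (hsub u hu).2).differentiableWithinAt
    have key := norm_le_of_norm_mul_re_pow_le hN hs hd hB0 (z := z) ?_ ?_
    · have hzn : ‖z - c‖ ^ 2 = z.re ^ 2 := by rw [hzc, Complex.norm_real, Real.norm_eq_abs, sq_abs]
      rw [hzn] at key
      have h3 : 0 < 5 / 16 * ρ ^ 2 := by positivity
      have h4 : ‖f z‖ * (5 / 16 * ρ ^ 2) ^ N ≤ B * (2 * (3 / 4 * ρ)) ^ N := by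
        refine le_trans ?_ key
        gcongr
        nlinarith
      rw [← le_div_iff₀ (by positivity)] at h4
      calc ‖f z‖ ≤ _ := h4
        _ = B * (2 * (3 / 4 * ρ) / (5 / 16 * ρ ^ 2)) ^ N := by rw [div_pow]; ring
        _ ≤ B * (5 / ρ) ^ N := by
          refine mul_le_mul_of_nonneg_left (pow_le_pow_left₀ (by positivity) ?_ _) hB0
          rw [div_le_div_iff₀ h3 hρ]
          nlinarith
    · intro u hu h0
      have hure : (u - c).re = u.re := by simp [hcre]
      rw [hure] at h0 ⊢
      exact hB u (hsub u (sphere_subset_closedBall hu)).1 h0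
    · rw [mem_closedBall, dist_eq_norm, hzc, Complex.norm_real, Real.norm_eq_abs]
      linarith

end MaximumPrinciple

/-! ### Removing singularities and a Liouville theorem for resolvents. -/

section Entire

open Filter Topology

variable {E : Type*} [NormedAddCommGroup E] [NormedSpace ℂ E]

/-- A function which near every point coincides, off that point, with a holomorphic function
agrees with an entire function wherever it is itself continuous. -/
theorem exists_entire_extension {f : ℂ → E}
    (hf : ∀ p : ℂ, ∃ h : ℂ → E, (∀ᶠ z in 𝓝 p, DifferentiableAt ℂ h z) ∧ f =ᶠ[𝓝[≠] p] h) :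
    ∃ F : ℂ → E, Differentiable ℂ F ∧ ∀ z, ContinuousAt f z → F z = f z := by
  -- The punctured limit does not see the default value that `f` may take at a singular point.
  refine ⟨fun z => limUnder (𝓝[≠] z) f, fun p => ?_, fun z hz => ?_⟩
  · obtain ⟨h, hd, he⟩ := hf p
    refine hd.self_of_nhds.congr_of_eventuallyEq ?_
    have he' := eventually_nhdsWithin_iff.1 he
    filter_upwards [hd, he'.eventually_nhds] with z hdz hez
    have hfz : f =ᶠ[𝓝[≠] z] h := by
      rcases eq_or_ne z p with rfl | hne
      · exact he
      · refine Filter.Eventually.filter_mono nhdsWithin_le_nhds ?_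
        filter_upwards [hez, isOpen_ne.mem_nhds hne] with w hw hwp using hw hwp
    exact ((hdz.continuousAt.tendsto.mono_left nhdsWithin_le_nhds).congr' hfz.symm).limUnder_eq
  · exact (hz.tendsto.mono_left nhdsWithin_le_nhds).limUnder_eq

variable [CompleteSpace E] {A : E →ₗ.[ℂ] E}

/-- If `z ↦ (z - A)⁻¹ v` extends to an entire function of polynomial growth, then `v = 0`. -/
theorem eq_zero_of_entire_resolvent {z₀ z₁ : ℂ} (h₀ : z₀ ∈ resolventSet A)
    (h₁ : z₁ ∈ resolventSet A) (hne : z₀ ≠ z₁) (m : ℕ) :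
    ∀ (v : E) (F : ℂ → E), Differentiable ℂ F →
      (∀ z ∈ resolventSet A, F z = resolvent A z v) →
      (∃ C : ℝ, ∀ z, ‖F z‖ ≤ C * (1 + ‖z‖) ^ m) → v = 0 := by
  induction m with
  | zero =>
    rintro v F hF hFR ⟨C, hC⟩
    have hb : Bornology.IsBounded (Set.range F) := by
      rw [isBounded_iff_forall_norm_le]
      refine ⟨C, ?_⟩
      rintro _ ⟨z, rfl⟩
      simpa using hC z
    -- By Liouville `F` is constant, so the resolvent identity gives `R(z₀) R(z₁) v = 0`, and
    -- resolvents are injective.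
    have h := hF.apply_eq_apply_of_bounded hb z₀ z₁
    rw [hFR z₀ h₀, hFR z₁ h₁, ← sub_eq_zero, resolvent_sub_apply h₀ h₁] at h
    have h2 := (smul_eq_zero.1 h).resolve_left (sub_ne_zero.2 hne.symm)
    exact eq_zero_of_resolvent_eq_zero h₁ (eq_zero_of_resolvent_eq_zero h₀ h2)
  | succ m ih =>
    rintro v F hF hFR ⟨C, hC⟩
    have hC0 : 0 ≤ C := by
      have := (norm_nonneg _).trans (hC 0)
      simpa using this
    have hd : Differentiable ℂ (fun z => -dslope F z₀ z) := by
      have : DifferentiableOn ℂ (dslope F z₀) Set.univ :=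
        (Complex.differentiableOn_dslope Filter.univ_mem).2 hF.differentiableOn
      exact (differentiableOn_univ.1 this).neg
    -- The negated difference quotient of `F` at `z₀` continues `z ↦ R(z) R(z₀) v` and has growth
    -- one degree lower. Induction then applies to `R(z₀) v` in place of `v`.
    refine eq_zero_of_resolvent_eq_zero h₀ (ih (resolvent A z₀ v) _ hd ?_ ?_)
    · have hopen := isOpen_resolventSet A
      have key : ∀ z ∈ resolventSet A, z ≠ z₀ →
          -dslope F z₀ z = resolvent A z (resolvent A z₀ v) := by
        intro z hz hzne
        rw [dslope_of_ne _ hzne, slope_def_module, hFR z hz, hFR z₀ h₀,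
          resolvent_sub_apply hz h₀, ← smul_neg, ← neg_smul, neg_sub, smul_smul,
          inv_mul_cancel₀ (sub_ne_zero.2 hzne), one_smul]
      intro z hz
      rcases eq_or_ne z z₀ with rfl | hzne
      · have hc1 : Tendsto (fun w => -dslope F z w) (𝓝[≠] z) (𝓝 (-dslope F z z)) :=
          (hd.continuous.tendsto z).mono_left nhdsWithin_le_nhds
        have hc2 : Tendsto (fun w => resolvent A w (resolvent A z v)) (𝓝[≠] z)
            (𝓝 (resolvent A z (resolvent A z v))) :=
          ((differentiableAt_resolvent_apply hz _).continuousAt.tendsto).mono_left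
            nhdsWithin_le_nhds
        refine tendsto_nhds_unique hc1 (hc2.congr' ?_)
        filter_upwards [nhdsWithin_le_nhds (hopen.mem_nhds hz), self_mem_nhdsWithin]
          with w hw hwz using (key w hw hwz).symm
      · exact key z hz hzne
    · obtain ⟨D, hD⟩ := (isCompact_closedBall z₀ 1).exists_bound_of_continuousOn
        hd.continuous.continuousOn
      have hFz₀ := norm_nonneg (F z₀)
      refine ⟨|D| + (C * (2 + ‖z₀‖) + ‖F z₀‖), fun z => ?_⟩
      have hone : 1 ≤ (1 + ‖z‖) ^ m := one_le_pow₀ (by linarith [norm_nonneg z])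
      by_cases hz : z ∈ Metric.closedBall z₀ 1
      · calc ‖-dslope F z₀ z‖ ≤ D := hD z hz
          _ ≤ |D| + (C * (2 + ‖z₀‖) + ‖F z₀‖) := by
            have := le_abs_self D
            have : 0 ≤ C * (2 + ‖z₀‖) := by positivity
            linarith
          _ ≤ _ := le_mul_of_one_le_right (by positivity) hone
      · have hz1 : 1 < ‖z - z₀‖ := by simpa [dist_eq_norm] using hz
        have hzne : z ≠ z₀ := by
          rintro rfl
          simp at hz1
          linarith
        have hz1' : 0 < ‖z - z₀‖ := by linarith
        have h5 : 1 + ‖z‖ ≤ (2 + ‖z₀‖) * ‖z - z₀‖ := by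
          have := norm_add_le (z - z₀) z₀
          rw [sub_add_cancel] at this
          nlinarith [norm_nonneg z₀]
        rw [norm_neg, dslope_of_ne _ hzne, slope_def_module, norm_smul, norm_inv,
          inv_mul_le_iff₀ hz1']
        calc ‖F z - F z₀‖ ≤ ‖F z‖ + ‖F z₀‖ := norm_sub_le _ _
          _ ≤ C * (1 + ‖z‖) ^ (m + 1) + ‖F z₀‖ := by gcongr; exact hC z
          _ = C * (1 + ‖z‖) * (1 + ‖z‖) ^ m + ‖F z₀‖ * 1 := by ring
          _ ≤ C * ((2 + ‖z₀‖) * ‖z - z₀‖) * (1 + ‖z‖) ^ m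
              + ‖F z₀‖ * (‖z - z₀‖ * (1 + ‖z‖) ^ m) := by
            gcongr
            nlinarith
          _ ≤ ‖z - z₀‖ * ((|D| + (C * (2 + ‖z₀‖) + ‖F z₀‖)) * (1 + ‖z‖) ^ m) := by
            have : 0 ≤ ‖z - z₀‖ * (|D| * (1 + ‖z‖) ^ m) := by positivity
            nlinarith

end Entire

/-! ### Mean-square bounds for exponential sums, and almost orthogonality of resolvents. -/

section SeparatedFrequencies

open MeasureTheory Set

/-- The constant `∑_{m ∈ ℤ} 3 / (1 + m²)`, which bounds `∑ 1 / (1 + s²)` over any `1`-separated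
set of reals. -/
def separationConst : ℝ := ∑' m : ℤ, 3 / (1 + (m : ℝ) ^ 2)

theorem summable_three_div_one_add_sq : Summable fun m : ℤ => 3 / (1 + (m : ℝ) ^ 2) := by
  have h : Summable fun m : ℤ => 3 * (1 / (m : ℝ) ^ 2) :=
    (Real.summable_one_div_int_pow.2 one_lt_two).mul_left 3
  refine Summable.of_norm_bounded_eventually h ?_
  filter_upwards [(Set.finite_singleton (0 : ℤ)).compl_mem_cofinite] with m hm
  have hm : (m : ℝ) ≠ 0 := by exact_mod_cast hm
  have : 0 < (m : ℝ) ^ 2 := by positivity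
  rw [Real.norm_of_nonneg (by positivity), mul_one_div]
  gcongr
  linarith

theorem separationConst_nonneg : 0 ≤ separationConst := tsum_nonneg fun m => by positivity

theorem one_div_one_add_sq_le_floor (s : ℝ) :
    1 / (1 + s ^ 2) ≤ 3 / (1 + (⌊s⌋ : ℝ) ^ 2) := by
  have h1 := Int.floor_le s
  have h2 := Int.lt_floor_add_one s
  rw [div_le_div_iff₀ (by positivity) (by positivity)]
  nlinarith [sq_nonneg (s + (s - ⌊s⌋)), mul_nonneg (sub_nonneg.2 h1) (sub_nonneg.2 h2.le),
    sq_nonneg s]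

theorem floor_injOn_of_separated {ι : Type*} {T : Set ι} {s : ι → ℝ}
    (hs : ∀ j ∈ T, ∀ k ∈ T, j ≠ k → 1 ≤ |s j - s k|) :
    InjOn (fun j => ⌊s j⌋) T := by
  intro j hj k hk hjk
  by_contra hne
  have := Int.abs_sub_lt_one_of_floor_eq_floor hjk
  linarith [hs j hj k hk hne]

theorem sum_one_div_one_add_sq_le {ι : Type*} (F : Finset ι) {s : ι → ℝ}
    (hs : ∀ j ∈ F, ∀ k ∈ F, j ≠ k → 1 ≤ |s j - s k|) :
    ∑ j ∈ F, 1 / (1 + s j ^ 2) ≤ separationConst := by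
  calc ∑ j ∈ F, 1 / (1 + s j ^ 2) ≤ ∑ j ∈ F, 3 / (1 + (⌊s j⌋ : ℝ) ^ 2) :=
        Finset.sum_le_sum fun j _ => one_div_one_add_sq_le_floor _
    _ = ∑ m ∈ F.image fun j => ⌊s j⌋, 3 / (1 + (m : ℝ) ^ 2) :=
        (Finset.sum_image (f := fun m : ℤ => 3 / (1 + (m : ℝ) ^ 2))
          (floor_injOn_of_separated hs)).symm
    _ ≤ _ := summable_three_div_one_add_sq.sum_le_tsum _ fun m _ => by positivity

/-- Schur test: `c_j c_k ≤ (c_j² + c_k²)/2`, and by symmetry of the kernel both halves are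
controlled by row sums. -/
theorem sum_sum_mul_mul_le {ι : Type*} (F : Finset ι) {c : ι → ℝ} {g : ι → ι → ℝ} {G : ℝ}
    (hg : ∀ j k, 0 ≤ g j k) (hsymm : ∀ j k, g j k = g k j)
    (hG : ∀ j ∈ F, ∑ k ∈ F, g j k ≤ G) :
    ∑ j ∈ F, ∑ k ∈ F, c j * c k * g j k ≤ G * ∑ j ∈ F, c j ^ 2 := by
  have h1 : ∑ j ∈ F, ∑ k ∈ F, c j * c k * g j k
      ≤ ∑ j ∈ F, ∑ k ∈ F, (c j ^ 2 / 2 * g j k + c k ^ 2 / 2 * g j k) := by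
    refine Finset.sum_le_sum fun j _ => Finset.sum_le_sum fun k _ => ?_
    nlinarith [mul_nonneg (sq_nonneg (c j - c k)) (hg j k)]
  have h2 : ∑ j ∈ F, ∑ k ∈ F, c k ^ 2 / 2 * g j k = ∑ j ∈ F, ∑ k ∈ F, c j ^ 2 / 2 * g j k := by
    rw [Finset.sum_comm]
    simp_rw [hsymm]
  refine h1.trans ?_
  simp_rw [Finset.sum_add_distrib]
  rw [h2, ← two_mul, Finset.mul_sum, Finset.mul_sum]
  refine Finset.sum_le_sum fun j hj => ?_
  rw [← Finset.mul_sum]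
  nlinarith [mul_le_mul_of_nonneg_left (hG j hj) (sq_nonneg (c j))]

/-- The exponential sum `∑_{k ∈ F} d_k e^{-i ω_k t}`. -/
def expSum {ι : Type*} (F : Finset ι) (d : ι → ℂ) (ω : ι → ℝ) (t : ℝ) : ℂ :=
  ∑ k ∈ F, d k * Complex.exp (-(Complex.I * ω k * t))

variable {ι : Type*} {F : Finset ι} {d : ι → ℂ} {ω : ι → ℝ} {a r : ℝ}

theorem continuous_expSum : Continuous (expSum F d ω) := by
  unfold expSum
  fun_prop

theorem norm_expSum_le (t : ℝ) : ‖expSum F d ω t‖ ≤ ∑ k ∈ F, ‖d k‖ := by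
  refine (norm_sum_le _ _).trans (Finset.sum_le_sum fun k _ => ?_)
  rw [norm_mul, Complex.norm_exp]
  simp

theorem integrableOn_exp_mul_norm_expSum_sq (ha : 0 < a) (σ : ℝ) :
    IntegrableOn (fun t : ℝ => Real.exp (-(a * t)) * ‖expSum F d ω (σ * t)‖ ^ 2) (Ioi 0) := by
  have h : IntegrableOn (fun t : ℝ => t ^ 0 * Real.exp (-(a * t)) * (∑ k ∈ F, ‖d k‖) ^ 2)
    (Ioi 0) := (integrableOn_pow_mul_exp_neg 0 ha).mul_const _
  have hcont := continuous_expSum (F := F) (d := d) (ω := ω)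
  refine Integrable.mono' h (Continuous.aestronglyMeasurable (by fun_prop)) ?_
  refine Filter.Eventually.of_forall fun t => ?_
  rw [Real.norm_of_nonneg (by positivity), pow_zero, one_mul]
  gcongr
  exact norm_expSum_le _

theorem ofReal_exp_mul_norm_expSum_sq (σ t : ℝ) :
    ((Real.exp (-(a * t)) * ‖expSum F d ω (σ * t)‖ ^ 2 : ℝ) : ℂ)
      = ∑ j ∈ F, ∑ k ∈ F, d j * (starRingEnd ℂ) (d k)
        * Complex.exp (-(a + Complex.I * (σ * (ω j - ω k) : ℝ)) * t) := by
  have h1 : ((‖expSum F d ω (σ * t)‖ ^ 2 : ℝ) : ℂ)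
      = expSum F d ω (σ * t) * (starRingEnd ℂ) (expSum F d ω (σ * t)) := by
    rw [Complex.mul_conj, Complex.normSq_eq_norm_sq]
  rw [Complex.ofReal_mul, h1, expSum, map_sum, Finset.sum_mul_sum, Finset.mul_sum]
  refine Finset.sum_congr rfl fun j _ => ?_
  rw [Finset.mul_sum]
  refine Finset.sum_congr rfl fun k _ => ?_
  rw [map_mul, ← Complex.exp_conj, Complex.ofReal_exp]
  have : Complex.exp (-(a + Complex.I * (σ * (ω j - ω k) : ℝ)) * t)
      = Complex.exp ((-(a * t) : ℝ)) * (Complex.exp (-(Complex.I * ω j * (σ * t : ℝ)))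
        * Complex.exp ((starRingEnd ℂ) (-(Complex.I * ω k * (σ * t : ℝ))))) := by
    rw [← Complex.exp_add, ← Complex.exp_add]
    congr 1
    simp
    ring
  rw [this]
  ring

theorem integral_exp_mul_norm_expSum_sq (ha : 0 < a) (σ : ℝ) :
    ((∫ t in Ioi (0 : ℝ), Real.exp (-(a * t)) * ‖expSum F d ω (σ * t)‖ ^ 2 : ℝ) : ℂ)
      = ∑ j ∈ F, ∑ k ∈ F, d j * (starRingEnd ℂ) (d k)
        * (1 / (a + Complex.I * (σ * (ω j - ω k) : ℝ))) := by
  have hre : ∀ b : ℝ, (-((a : ℂ) + Complex.I * b)).re < 0 := by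
    intro b
    simp [ha]
  rw [← integral_complex_ofReal]
  simp_rw [ofReal_exp_mul_norm_expSum_sq]
  have hi : ∀ j k, IntegrableOn (fun t : ℝ => d j * (starRingEnd ℂ) (d k)
      * Complex.exp (-(a + Complex.I * (σ * (ω j - ω k) : ℝ)) * t)) (Ioi 0) := fun j k =>
    (integrableOn_exp_mul_complex_Ioi (hre _) 0).const_mul _
  rw [integral_finsetSum _ fun j _ => integrable_finsetSum _ fun k _ => hi j k]
  refine Finset.sum_congr rfl fun j _ => ?_
  rw [integral_finsetSum _ fun k _ => hi j k]
  refine Finset.sum_congr rfl fun k _ => ?_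
  rw [integral_const_mul, integral_exp_mul_complex_Ioi (hre _)]
  rw [Complex.ofReal_zero, mul_zero, Complex.exp_zero, neg_div_neg_eq]

/-- Expanding the square produces the kernel `1/(a + i(ω_j - ω_k))`, which decays too slowly to sum.
Adding the nonnegative integral over reversed time replaces it by the Poisson kernel `2a/(a² + (ω_j
- ω_k)²)`. Its row sums are bounded after rescaling by `r`, using `a ≤ r`, and the Schur test
concludes. -/
theorem integral_exp_mul_norm_expSum_sq_le (ha : 0 < a) (har : a ≤ r)
    (hω : ∀ j ∈ F, ∀ k ∈ F, j ≠ k → r ≤ |ω j - ω k|) :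
    ∫ t in Ioi (0 : ℝ), Real.exp (-(a * t)) * ‖expSum F d ω t‖ ^ 2
      ≤ 2 / a * separationConst * ∑ k ∈ F, ‖d k‖ ^ 2 := by
  have hr : 0 < r := ha.trans_le har
  set J : ℝ → ℝ := fun σ =>
    ∫ t in Ioi (0 : ℝ), Real.exp (-(a * t)) * ‖expSum F d ω (σ * t)‖ ^ 2 with hJ
  have hJ1 : ∫ t in Ioi (0 : ℝ), Real.exp (-(a * t)) * ‖expSum F d ω t‖ ^ 2 = J 1 := by
    simp [hJ]
  have hJm : 0 ≤ J (-1) := integral_nonneg fun t => by positivity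
  have hsum : ((J 1 + J (-1) : ℝ) : ℂ) = ∑ j ∈ F, ∑ k ∈ F, d j * (starRingEnd ℂ) (d k)
      * ((2 * a / (a ^ 2 + (ω j - ω k) ^ 2) : ℝ) : ℂ) := by
    rw [Complex.ofReal_add, integral_exp_mul_norm_expSum_sq ha,
      integral_exp_mul_norm_expSum_sq ha, ← Finset.sum_add_distrib]
    refine Finset.sum_congr rfl fun j _ => ?_
    rw [← Finset.sum_add_distrib]
    refine Finset.sum_congr rfl fun k _ => ?_
    rw [← mul_add]
    congr 1
    have hne : ∀ b : ℝ, (a : ℂ) + Complex.I * b ≠ 0 := by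
      intro b h
      have := congrArg Complex.re h
      simp at this
      exact ha.ne' this
    have h1 := hne (1 * (ω j - ω k))
    have h2 := hne (-1 * (ω j - ω k))
    have h3 : ((a : ℂ) ^ 2 + (ω j - ω k) ^ 2) ≠ 0 := by
      have : (a : ℝ) ^ 2 + (ω j - ω k) ^ 2 ≠ 0 := by positivity
      exact_mod_cast this
    push_cast at h1 h2 ⊢
    rw [div_add_div _ _ h1 h2, div_eq_div_iff (mul_ne_zero h1 h2) h3]
    linear_combination (2 * (a : ℂ) * (ω j - ω k) ^ 2) * Complex.I_sq
  have hle : J 1 + J (-1) ≤ ∑ j ∈ F, ∑ k ∈ F, ‖d j‖ * ‖d k‖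
      * (2 * a / (a ^ 2 + (ω j - ω k) ^ 2)) := by
    have h1 : J 1 + J (-1) ≤ ‖((J 1 + J (-1) : ℝ) : ℂ)‖ := by
      rw [Complex.norm_real]
      exact le_abs_self _
    rw [hsum] at h1
    refine h1.trans ((norm_sum_le _ _).trans (Finset.sum_le_sum fun j _ =>
      (norm_sum_le _ _).trans (Finset.sum_le_sum fun k _ => ?_)))
    rw [norm_mul, norm_mul, RCLike.norm_conj, Complex.norm_real,
      Real.norm_of_nonneg (by positivity)]
  rw [hJ1]
  refine (le_add_of_nonneg_right hJm).trans (hle.trans ?_)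
  refine sum_sum_mul_mul_le F (fun j k => by positivity) (fun j k => ?_) fun j hj => ?_
  · rw [← neg_sub (ω k), neg_sq]
  · have h1 := sum_one_div_one_add_sq_le F (s := fun k => (ω j - ω k) / r) fun k hk m hm hkm => by
      rw [← sub_div, abs_div, abs_of_pos hr, le_div_iff₀ hr, one_mul, sub_sub_sub_cancel_left,
        abs_sub_comm]
      exact hω k hk m hm hkm
    calc _ ≤ ∑ k ∈ F, 2 / a * (1 / (1 + ((ω j - ω k) / r) ^ 2)) := by
          refine Finset.sum_le_sum fun k _ => ?_
          rw [div_mul_div_comm, mul_one, div_le_div_iff₀ (by positivity) (by positivity)]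
          have h2 : a ^ 2 * ((ω j - ω k) / r) ^ 2 ≤ (ω j - ω k) ^ 2 := by
            rw [div_pow, ← mul_div_assoc, div_le_iff₀ (by positivity), mul_comm]
            gcongr
          nlinarith
      _ ≤ _ := by
          rw [← Finset.mul_sum]
          gcongr

variable {E : Type*} [NormedAddCommGroup E] [NormedSpace ℂ E] [CompleteSpace E]
  {n : ℕ} {A : E →ₗ.[ℂ] E} {S : ℝ → E →L[ℂ] E} {M : ℝ}

theorem GeneratesIntegratedSemigroup.sum_smul_resolvent_eq
    (hS : GeneratesIntegratedSemigroup n A S) (hM : ∀ t, 0 ≤ t → ‖S t‖ ≤ M * (1 + t ^ n))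
    (hρ : ∀ z : ℂ, 0 < z.re → z ∈ resolventSet A) (ha : 0 < a) (c : ι → ℂ) (y : E) :
    ∑ k ∈ F, c k • resolvent A (a + Complex.I * ω k) y
      = ∫ t in Ioi (0 : ℝ), ((Real.exp (-(a * t)) : ℝ) *
        expSum F (fun k => c k * (a + Complex.I * ω k) ^ n) ω t) • S t y := by
  have hz : ∀ k, 0 < ((a : ℂ) + Complex.I * ω k).re := by simp [ha]
  have hi : ∀ k, IntegrableOn (fun t : ℝ => (c k * (a + Complex.I * ω k) ^ n) •
      Complex.exp (-(a + Complex.I * ω k) * t) • S t y) (Ioi 0) := fun k =>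
    (integrableOn_exp_smul (hS.1 y) (norm_apply_le_of_norm_le hM y) (hz k)).smul _
  simp_rw [hS.resolvent_eq_laplace hM hρ (hz _), smul_smul, ← integral_smul]
  rw [← integral_finsetSum _ fun k _ => hi k]
  refine integral_congr_ae (Filter.Eventually.of_forall fun t => ?_)
  simp only [expSum]
  rw [Finset.mul_sum, Finset.sum_smul]
  refine Finset.sum_congr rfl fun k _ => ?_
  rw [smul_smul]
  congr 1
  rw [show -((a : ℂ) + Complex.I * ω k) * t
    = ((-(a * t) : ℝ) : ℂ) + -(Complex.I * ω k * t) by push_cast; ring, Complex.exp_add,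
    Complex.ofReal_exp]
  ring

/-- For `r`-separated frequencies the resolvents on a vertical line close to the imaginary axis
add up like orthogonal vectors. -/
theorem GeneratesIntegratedSemigroup.norm_sum_smul_resolvent_le
    (hS : GeneratesIntegratedSemigroup n A S) (hM : ∀ t, 0 ≤ t → ‖S t‖ ≤ M * (1 + t ^ n))
    (hρ : ∀ z : ℂ, 0 < z.re → z ∈ resolventSet A)
    (ha : 0 < a) (har : a ≤ r) (ha1 : a ≤ 1)
    (hω : ∀ j ∈ F, ∀ k ∈ F, j ≠ k → r ≤ |ω j - ω k|) (c : ι → ℂ) (y : E) {D : ℝ} (hD : 0 < D)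
    (hc : ∑ k ∈ F, ‖c k * (a + Complex.I * ω k) ^ n‖ ^ 2 ≤ D ^ 2) :
    ‖∑ k ∈ F, c k • resolvent A (a + Complex.I * ω k) y‖ * a ^ (n + 1)
      ≤ M * (1 + (2 * n).factorial + separationConst) * D * ‖y‖ := by
  rw [hS.sum_smul_resolvent_eq hM hρ ha]
  set d : ι → ℂ := fun k => c k * (a + Complex.I * ω k) ^ n
  have hM0 : 0 ≤ M := by
    have := (norm_nonneg _).trans (hM 0 le_rfl)
    have h0 : (0 : ℝ) < 1 + 0 ^ n := by positivity
    exact nonneg_of_mul_nonneg_left this h0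
  -- Weight for the inequality `q (1 + t^n) ≤ p (1 + t^(2n)) + q²/(2p)`: with this value both
  -- integrals are of order `D / a^(n+1)`.
  set p : ℝ := D * a ^ n with hp
  have hp0 : 0 < p := by positivity
  have hi1 : IntegrableOn (fun t : ℝ => p * (t ^ 0 * Real.exp (-(a * t))
      + t ^ (2 * n) * Real.exp (-(a * t)))) (Ioi 0) :=
    ((integrableOn_pow_mul_exp_neg 0 ha).add (integrableOn_pow_mul_exp_neg _ ha)).const_mul p
  have hi2 : IntegrableOn (fun t : ℝ => 1 / (2 * p) *
      (Real.exp (-(a * t)) * ‖expSum F d ω t‖ ^ 2)) (Ioi 0) := by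
    have := integrableOn_exp_mul_norm_expSum_sq (F := F) (d := d) (ω := ω) ha 1
    simp only [one_mul] at this
    exact this.const_mul _
  have hle : ‖∫ t in Ioi (0 : ℝ), ((Real.exp (-(a * t)) : ℝ) * expSum F d ω t) • S t y‖
      ≤ ∫ t in Ioi (0 : ℝ), M * ‖y‖ * (p * (t ^ 0 * Real.exp (-(a * t))
      + t ^ (2 * n) * Real.exp (-(a * t))) + 1 / (2 * p) *
      (Real.exp (-(a * t)) * ‖expSum F d ω t‖ ^ 2)) := by
    refine norm_integral_le_of_norm_le ((hi1.add hi2).const_mul _) ?_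
    refine (ae_restrict_iff' measurableSet_Ioi).2 (Filter.Eventually.of_forall fun t ht => ?_)
    have h1 := norm_apply_le_of_norm_le hM y t (le_of_lt ht)
    rw [norm_smul, norm_mul, Complex.norm_real, Real.norm_of_nonneg (Real.exp_pos _).le]
    set q := ‖expSum F d ω t‖
    have h2 : q * (1 + t ^ n) ≤ p * (1 + t ^ (2 * n)) + 1 / (2 * p) * q ^ 2 := by
      have h3 : q * (1 + t ^ n) ≤ p / 2 * (1 + t ^ n) ^ 2 + 1 / (2 * p) * q ^ 2 := by
        have h4 : p / 2 * (1 + t ^ n) ^ 2 + 1 / (2 * p) * q ^ 2 - q * (1 + t ^ n)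
            = (p * (1 + t ^ n) - q) ^ 2 / (2 * p) := by
          field_simp
          ring
        have : 0 ≤ (p * (1 + t ^ n) - q) ^ 2 / (2 * p) := by positivity
        linarith
      have h5 : p / 2 * (1 + t ^ n) ^ 2 ≤ p * (1 + t ^ (2 * n)) := by
        rw [mul_comm 2 n, pow_mul]
        nlinarith [mul_nonneg hp0.le (sq_nonneg (1 - t ^ n))]
      linarith
    calc Real.exp (-(a * t)) * q * ‖S t y‖
        ≤ Real.exp (-(a * t)) * q * (M * ‖y‖ * (1 + t ^ n)) := by gcongr
      _ = M * ‖y‖ * Real.exp (-(a * t)) * (q * (1 + t ^ n)) := by ring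
      _ ≤ M * ‖y‖ * Real.exp (-(a * t)) * (p * (1 + t ^ (2 * n)) + 1 / (2 * p) * q ^ 2) := by
          gcongr
      _ = _ := by ring
  rw [integral_const_mul, integral_add hi1 hi2, integral_const_mul, integral_const_mul,
    integral_add (integrableOn_pow_mul_exp_neg 0 ha) (integrableOn_pow_mul_exp_neg _ ha),
    integral_pow_mul_exp_neg _ ha, integral_pow_mul_exp_neg _ ha] at hle
  have hE := integral_exp_mul_norm_expSum_sq_le (d := d) ha har hω
  have hE2 : ∫ t in Ioi (0 : ℝ), Real.exp (-(a * t)) * ‖expSum F d ω t‖ ^ 2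
      ≤ 2 / a * separationConst * D ^ 2 := by
    refine hE.trans ?_
    have := separationConst_nonneg
    gcongr
  have hA : p * ((Nat.factorial 0 : ℝ) / a ^ (0 + 1) + (2 * n).factorial / a ^ (2 * n + 1))
      ≤ D * (1 + (2 * n).factorial) / a ^ (n + 1) := by
    have h6 : (Nat.factorial 0 : ℝ) / a ^ (0 + 1) ≤ 1 / a ^ (2 * n + 1) := by
      rw [Nat.factorial_zero, Nat.cast_one]
      refine one_div_le_one_div_of_le (by positivity) ?_
      exact pow_le_pow_of_le_one ha.le ha1 (by omega)
    calc _ ≤ p * (1 / a ^ (2 * n + 1) + (2 * n).factorial / a ^ (2 * n + 1)) := by gcongr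
      _ = _ := by
        rw [hp]
        field_simp
        ring
  have hB : 1 / (2 * p) * (2 / a * separationConst * D ^ 2)
      = D * separationConst / a ^ (n + 1) := by
    rw [hp]
    field_simp
    ring
  have hfin : ‖∫ t in Ioi (0 : ℝ), ((Real.exp (-(a * t)) : ℝ) * expSum F d ω t) • S t y‖
      ≤ M * (1 + (2 * n).factorial + separationConst) * D * ‖y‖ / a ^ (n + 1) := by
    refine hle.trans ?_
    calc _ ≤ M * ‖y‖ * (D * (1 + (2 * n).factorial) / a ^ (n + 1)
          + D * separationConst / a ^ (n + 1)) := by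
          rw [← hB]
          gcongr
      _ = _ := by ring
  rwa [le_div_iff₀ (by positivity)] at hfin

end SeparatedFrequencies

/-! ### Holomorphy of Cauchy transforms off the circle. -/

section CauchyTransform

open Metric Set

variable {E : Type*} [NormedAddCommGroup E] [NormedSpace ℂ E]

/-- The Cauchy transform `(2πi)⁻¹ ∮ (z - w)⁻¹ f(w) dw` over the circle of centre `c` and
radius `r`. -/
def cauchyTransform (f : ℂ → E) (c : ℂ) (r : ℝ) (z : ℂ) : E :=
  (2 * (π : ℂ) * Complex.I)⁻¹ • ∮ w in C(c, r), (z - w)⁻¹ • f w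

theorem circleIntegral_eq_zero_center (f : ℂ → E) (c : ℂ) (r : ℝ) :
    (∮ z in C(c, r), f z) = ∮ ζ in C(0, r), f (c + ζ) := by
  simp [circleIntegral, circleMap]

theorem differentiableAt_cauchyTransform {f : ℂ → E} {c z : ℂ} {r : ℝ} (hr : 0 ≤ r)
    (hf : ContinuousOn f (sphere c r)) (hz : z ∉ sphere c r) :
    DifferentiableAt ℂ (cauchyTransform f c r) z := by
  obtain ⟨δ, hδ, hball⟩ := Metric.isOpen_iff.1 (isClosed_sphere (x := c) (ε := r)).isOpen_compl z hz
  have hδ2 : 0 < δ / 2 := by positivity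
  have hdist : ∀ u ∈ ball z (δ / 2), ∀ θ : ℝ, δ / 2 ≤ ‖u - circleMap c r θ‖ := by
    intro u hu θ
    by_contra! h
    have h1 : circleMap c r θ ∈ ball z δ := by
      rw [mem_ball, dist_comm]
      calc dist z (circleMap c r θ) ≤ dist z u + dist u (circleMap c r θ) := dist_triangle _ _ _
        _ < δ / 2 + δ / 2 := by
          rw [dist_eq_norm u]
          rw [mem_ball, dist_comm] at hu
          linarith
        _ = δ := by ring
    exact hball h1 (circleMap_mem_sphere c hr θ)
  have hne : ∀ u ∈ ball z (δ / 2), ∀ θ : ℝ, u - circleMap c r θ ≠ 0 := by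
    intro u hu θ h
    have := hdist u hu θ
    rw [h, norm_zero] at this
    linarith
  have hfc : Continuous fun θ : ℝ => f (circleMap c r θ) :=
    hf.comp_continuous (continuous_circleMap c r) (circleMap_mem_sphere c hr)
  have hdc : Continuous fun θ : ℝ => deriv (circleMap c r) θ := by
    simp only [deriv_circleMap]
    fun_prop
  have hcont : ∀ u ∈ ball z (δ / 2), ∀ k : ℕ, Continuous fun θ : ℝ =>
      deriv (circleMap c r) θ • ((u - circleMap c r θ)⁻¹ ^ k) • f (circleMap c r θ) := by
    intro u hu k
    exact hdc.smul (((Continuous.inv₀ (continuous_const.sub (continuous_circleMap c r))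
      (hne u hu)).pow k).smul hfc)
  have hz0 : z ∈ ball z (δ / 2) := mem_ball_self hδ2
  refine DifferentiableAt.const_smul ?_ _
  refine (intervalIntegral.hasDerivAt_integral_of_dominated_loc_of_deriv_le
    (F := fun (u : ℂ) (θ : ℝ) =>
      deriv (circleMap c r) θ • (u - circleMap c r θ)⁻¹ • f (circleMap c r θ))
    (F' := fun (u : ℂ) (θ : ℝ) => deriv (circleMap c r) θ •
      (-((u - circleMap c r θ)⁻¹ ^ 2)) • f (circleMap c r θ))
    (bound := fun θ => ‖deriv (circleMap c r) θ‖ * ((δ / 2)⁻¹ ^ 2 * ‖f (circleMap c r θ)‖))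
    (ball_mem_nhds z hδ2) ?_ ?_ ?_ ?_ ?_ ?_).2.differentiableAt
  · filter_upwards [ball_mem_nhds z hδ2] with u hu
    simpa using (hcont u hu 1).aestronglyMeasurable
  · simpa using (hcont z hz0 1).intervalIntegrable 0 (2 * π)
  · have := (hcont z hz0 2).neg
    refine Continuous.aestronglyMeasurable (this.congr fun θ => ?_)
    simp only [Pi.neg_apply, neg_smul, smul_neg]
  · refine Filter.Eventually.of_forall fun θ _ u hu => ?_
    rw [norm_smul, norm_smul, norm_neg, norm_pow, norm_inv]
    gcongr
    exact hdist u hu θ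
  · exact (Continuous.mul hdc.norm (continuous_const.mul hfc.norm)).intervalIntegrable _ _
  · refine Filter.Eventually.of_forall fun θ _ u hu => ?_
    have h1 : HasDerivAt (fun u : ℂ => (u - circleMap c r θ)⁻¹)
        (-((u - circleMap c r θ)⁻¹ ^ 2)) u := by
      have := ((hasDerivAt_id u).sub_const (circleMap c r θ)).inv (hne u hu θ)
      refine this.congr_deriv ?_
      rw [inv_pow, neg_div, one_div]
      rfl
    exact (h1.smul_const _).const_smul _

end CauchyTransform

/-! ### Riesz projections at isolated spectral points. -/

section Riesz

open Metric Set

variable {E : Type*} [NormedAddCommGroup E] [NormedSpace ℂ E] [CompleteSpace E]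
  {A : E →ₗ.[ℂ] E} {c z : ℂ} {r : ℝ}

theorem continuousOn_resolvent_sphere (hr : r ≠ 0)
    (hiso : ∀ z ∈ closedBall c r, z ≠ c → z ∈ resolventSet A) :
    ContinuousOn (resolvent A) (sphere c r) := fun w hw =>
  (differentiableAt_resolvent (hiso w (sphere_subset_closedBall hw)
    (ne_of_mem_sphere hw hr))).continuousAt.continuousWithinAt

theorem circleIntegrable_resolvent_apply (hr : 0 < r)
    (hiso : ∀ z ∈ closedBall c r, z ≠ c → z ∈ resolventSet A) (x : E) :
    CircleIntegrable (fun z => resolvent A z x) c r :=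
  ((continuousOn_resolvent_sphere hr.ne' hiso).clm_apply continuousOn_const).circleIntegrable hr.le

theorem rieszProjection_apply (hr : 0 < r)
    (hiso : ∀ z ∈ closedBall c r, z ≠ c → z ∈ resolventSet A) (x : E) :
    rieszProjection A c r x
      = (2 * (π : ℂ) * Complex.I)⁻¹ • ∮ z in C(c, r), resolvent A z x := by
  rw [rieszProjection, smul_apply, circleIntegral, circleIntegral]
  congr 1
  exact ContinuousLinearMap.intervalIntegral_apply
    (((continuousOn_resolvent_sphere hr.ne' hiso).circleIntegrable hr.le).out) x

theorem rieszProjection_eq_of_le {r' : ℝ} (hr : 0 < r) (hrr' : r ≤ r')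
    (hiso : ∀ z ∈ closedBall c r', z ≠ c → z ∈ resolventSet A) :
    rieszProjection A c r' = rieszProjection A c r := by
  rw [rieszProjection, rieszProjection]
  congr 1
  refine Complex.circleIntegral_eq_of_differentiable_on_annulus_off_countable hr hrr'
    countable_empty (fun z hz => ?_) fun z hz => ?_
  · refine (differentiableAt_resolvent (hiso z hz.1 ?_)).continuousAt.continuousWithinAt
    rintro rfl
    exact hz.2 (mem_ball_self hr)
  · refine differentiableAt_resolvent (hiso z (ball_subset_closedBall hz.1.1) ?_)
    rintro rfl
    exact hz.1.2 (mem_closedBall_self hr.le)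

theorem rieszProjection_eq {r' : ℝ} (hr : 0 < r) (hr' : 0 < r')
    (hiso : ∀ z ∈ closedBall c r, z ≠ c → z ∈ resolventSet A)
    (hiso' : ∀ z ∈ closedBall c r', z ≠ c → z ∈ resolventSet A) :
    rieszProjection A c r = rieszProjection A c r' := by
  rcases le_total r r' with h | h
  · exact (rieszProjection_eq_of_le hr h hiso').symm
  · exact rieszProjection_eq_of_le hr' h hiso

theorem differentiableAt_cauchyTransform_resolvent (hr : 0 < r)
    (hiso : ∀ z ∈ closedBall c r, z ≠ c → z ∈ resolventSet A) (x : E) (hz : z ∉ sphere c r) :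
    DifferentiableAt ℂ (cauchyTransform (fun w => resolvent A w x) c r) z :=
  differentiableAt_cauchyTransform hr.le
    ((continuousOn_resolvent_sphere hr.ne' hiso).clm_apply continuousOn_const) hz

/-- Integrating `R(z) R(w) = (z - w)⁻¹ (R(w) - R(z))` over `w` separates a function of `z`
holomorphic off the circle from a multiple of `R(z) x`. The scalar integral equals `0` outside the
disc and `-1` inside, after normalisation. -/
theorem resolvent_rieszProjection_apply (hr : 0 < r)
    (hiso : ∀ z ∈ closedBall c r, z ≠ c → z ∈ resolventSet A) (x : E)
    (hz : z ∈ resolventSet A) (hzs : z ∉ sphere c r) :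
    resolvent A z (rieszProjection A c r x)
      = cauchyTransform (fun w => resolvent A w x) c r z
        - ((2 * (π : ℂ) * Complex.I)⁻¹ * ∮ w in C(c, r), (z - w)⁻¹) • resolvent A z x := by
  have hne : ∀ w ∈ sphere c r, z - w ≠ 0 := by
    intro w hw h
    rw [sub_eq_zero.1 h] at hzs
    exact hzs hw
  have hinv : ContinuousOn (fun w => (z - w)⁻¹) (sphere c r) :=
    (continuousOn_const.sub continuousOn_id).inv₀ hne
  have hRc : ContinuousOn (fun w => resolvent A w x) (sphere c r) :=
    (continuousOn_resolvent_sphere hr.ne' hiso).clm_apply continuousOn_const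
  rw [rieszProjection_apply hr hiso, map_smul, cauchyTransform, mul_smul, ← smul_sub]
  congr 1
  have h1 : resolvent A z (∮ w in C(c, r), resolvent A w x)
      = ∮ w in C(c, r), resolvent A z (resolvent A w x) := by
    rw [circleIntegral, circleIntegral, ← ContinuousLinearMap.intervalIntegral_comp_comm]
    · simp
    · exact (circleIntegrable_resolvent_apply hr hiso x).out
  rw [h1, ← circleIntegral.integral_smul_const, ← circleIntegral.integral_sub
    (f := fun w => (z - w)⁻¹ • resolvent A w x) (g := fun w => (z - w)⁻¹ • resolvent A z x)
    ((hinv.smul hRc).circleIntegrable hr.le)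
    ((hinv.smul continuousOn_const).circleIntegrable hr.le)]
  refine circleIntegral.integral_congr hr.le fun w hw => ?_
  have hw' := hiso w (sphere_subset_closedBall hw) (ne_of_mem_sphere hw hr.ne')
  rw [← smul_sub, resolvent_sub_apply hw' hz, smul_smul, inv_mul_cancel₀ (hne w hw), one_smul,
    resolvent_comm hw' hz]

theorem resolvent_rieszProjection_apply_of_notMem (hr : 0 < r)
    (hiso : ∀ z ∈ closedBall c r, z ≠ c → z ∈ resolventSet A) (x : E)
    (hz : z ∈ resolventSet A) (hzc : z ∉ closedBall c r) :
    resolvent A z (rieszProjection A c r x)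
      = cauchyTransform (fun w => resolvent A w x) c r z := by
  have h0 : (∮ w in C(c, r), (z - w)⁻¹) = 0 := by
    refine Complex.circleIntegral_eq_zero_of_differentiable_on_off_countable hr.le countable_empty
      ?_ ?_
    · refine (continuousOn_const.sub continuousOn_id).inv₀ fun w hw h => ?_
      exact hzc ((sub_eq_zero.1 h : z = w) ▸ hw)
    · intro w hw
      refine ((differentiableAt_const z).sub differentiableAt_id).inv fun h => ?_
      exact hzc ((sub_eq_zero.1 h : z = w) ▸ ball_subset_closedBall hw.1)
  rw [resolvent_rieszProjection_apply hr hiso x hz fun h => hzc (sphere_subset_closedBall h), h0,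
    mul_zero, zero_smul, sub_zero]

theorem resolvent_rieszProjection_apply_of_mem (hr : 0 < r)
    (hiso : ∀ z ∈ closedBall c r, z ≠ c → z ∈ resolventSet A) (x : E)
    (hz : z ∈ resolventSet A) (hzc : z ∈ ball c r) :
    resolvent A z (rieszProjection A c r x)
      = cauchyTransform (fun w => resolvent A w x) c r z + resolvent A z x := by
  have h0 : (2 * (π : ℂ) * Complex.I)⁻¹ * (∮ w in C(c, r), (z - w)⁻¹) = -1 := by
    have h1 : (∮ w in C(c, r), (z - w)⁻¹) = -∮ w in C(c, r), (w - z)⁻¹ := by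
      rw [← neg_one_mul, ← circleIntegral.integral_const_mul]
      congr 1
      ext w
      rw [neg_one_mul, neg_inv, neg_sub]
    rw [h1, circleIntegral.integral_sub_inv_of_mem_ball hzc, mul_neg,
      inv_mul_cancel₀ Complex.two_pi_I_ne_zero]
  rw [resolvent_rieszProjection_apply hr hiso x hz, h0, neg_one_smul, sub_neg_eq_add]
  intro h
  rw [mem_sphere] at h
  rw [mem_ball] at hzc
  exact hzc.ne h

theorem circleIntegral_cauchyTransform_eq_zero {c' : ℂ} {r' : ℝ} (hr : 0 < r) (hr' : 0 < r')
    (hiso : ∀ z ∈ closedBall c r, z ≠ c → z ∈ resolventSet A)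
    (hdisj : ∀ z ∈ closedBall c' r', z ∉ sphere c r) (x : E) :
    (∮ z in C(c', r'), cauchyTransform (fun w => resolvent A w x) c r z) = 0 := by
  have hd : ∀ z ∈ closedBall c' r',
      DifferentiableAt ℂ (cauchyTransform (fun w => resolvent A w x) c r) z := fun z hz =>
    differentiableAt_cauchyTransform_resolvent hr hiso x (hdisj z hz)
  exact Complex.circleIntegral_eq_zero_of_differentiable_on_off_countable hr'.le countable_empty
    (fun z hz => (hd z hz).continuousAt.continuousWithinAt)
    (fun z hz => hd z (ball_subset_closedBall hz.1))

/-- The outer projection may be computed on the circle of radius `r/2`. There the Cauchy transform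
is holomorphic in the whole smaller disc and integrates to `0`, so only `R(z) x` contributes. -/
theorem rieszProjection_idem_apply (hr : 0 < r)
    (hiso : ∀ z ∈ closedBall c r, z ≠ c → z ∈ resolventSet A) (x : E) :
    rieszProjection A c r (rieszProjection A c r x) = rieszProjection A c r x := by
  have hr2 : 0 < r / 2 := by positivity
  have hlt : ∀ z ∈ closedBall c (r / 2), z ∈ ball c r := fun z hz =>
    closedBall_subset_ball (by linarith) hz
  have hiso2 : ∀ z ∈ closedBall c (r / 2), z ≠ c → z ∈ resolventSet A := fun z hz =>
    hiso z (ball_subset_closedBall (hlt z hz))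
  have hns : ∀ z ∈ closedBall c (r / 2), z ∉ sphere c r := fun z hz h => by
    have := hlt z hz
    rw [mem_ball] at this
    rw [mem_sphere] at h
    exact this.ne h
  have heq := rieszProjection_eq_of_le (A := A) hr2 (by linarith) hiso
  have h1 : rieszProjection A c r (rieszProjection A c r x)
      = (2 * (π : ℂ) * Complex.I)⁻¹ • ∮ z in C(c, r / 2),
        (cauchyTransform (fun w => resolvent A w x) c r z + resolvent A z x) := by
    nth_rewrite 1 [heq]
    rw [rieszProjection_apply hr2 hiso2]
    congr 1
    refine circleIntegral.integral_congr hr2.le fun z hz => ?_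
    exact resolvent_rieszProjection_apply_of_mem hr hiso x
      (hiso2 z (sphere_subset_closedBall hz) (ne_of_mem_sphere hz hr2.ne'))
      (hlt z (sphere_subset_closedBall hz))
  rw [h1, circleIntegral.integral_add _ (circleIntegrable_resolvent_apply hr2 hiso2 x),
    circleIntegral_cauchyTransform_eq_zero hr hr2 hiso hns, zero_add,
    ← rieszProjection_apply hr2 hiso2, ← heq]
  refine ContinuousOn.circleIntegrable hr2.le fun z hz => ?_
  exact (differentiableAt_cauchyTransform_resolvent hr hiso x
    (hns z (sphere_subset_closedBall hz))).continuousAt.continuousWithinAt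

/-- Over the second disc `z ↦ R(z) P x` is a Cauchy transform taken from outside the first circle,
hence holomorphic, and Cauchy's theorem applies. -/
theorem rieszProjection_apply_rieszProjection_eq_zero {c' : ℂ} {r' : ℝ} (hr : 0 < r)
    (hr' : 0 < r') (hiso : ∀ z ∈ closedBall c r, z ≠ c → z ∈ resolventSet A)
    (hiso' : ∀ z ∈ closedBall c' r', z ≠ c' → z ∈ resolventSet A)
    (hdisj : ∀ z ∈ closedBall c' r', z ∉ closedBall c r) (x : E) :
    rieszProjection A c' r' (rieszProjection A c r x) = 0 := by
  rw [rieszProjection_apply hr' hiso']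
  rw [circleIntegral.integral_congr hr'.le (g := cauchyTransform (fun w => resolvent A w x) c r),
    circleIntegral_cauchyTransform_eq_zero hr hr' hiso
      (fun z hz h => hdisj z hz (sphere_subset_closedBall h)), smul_zero]
  intro z hz
  have hz' := sphere_subset_closedBall hz
  exact resolvent_rieszProjection_apply_of_notMem hr hiso x
    (hiso' z hz' (ne_of_mem_sphere hz hr'.ne')) (hdisj z hz')

open Filter Topology in
/-- If the Riesz projection at an isolated point kills `v`, then `z ↦ (z - A)⁻¹ v` extends
holomorphically across that point. -/
theorem exists_extension_of_rieszProjection_eq_zero (hr : 0 < r)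
    (hiso : ∀ z ∈ closedBall c r, z ≠ c → z ∈ resolventSet A) {v : E}
    (hv : rieszProjection A c r v = 0) :
    ∃ h : ℂ → E, (∀ᶠ z in 𝓝 c, DifferentiableAt ℂ h z) ∧
      (fun z => resolvent A z v) =ᶠ[𝓝[≠] c] h := by
  refine ⟨fun z => -cauchyTransform (fun w => resolvent A w v) c r z, ?_, ?_⟩
  · filter_upwards [ball_mem_nhds c hr] with z hz
    refine (differentiableAt_cauchyTransform_resolvent hr hiso v fun h => ?_).neg
    rw [mem_ball] at hz
    rw [mem_sphere] at h
    exact hz.ne h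
  · filter_upwards [nhdsWithin_le_nhds (ball_mem_nhds c hr), self_mem_nhdsWithin] with z hz hzc
    have := resolvent_rieszProjection_apply_of_mem hr hiso v
      (hiso z (ball_subset_closedBall hz) hzc) hz
    rw [hv, map_zero] at this
    exact eq_neg_of_add_eq_zero_right this.symm

/-- This is how regularity of `x` becomes decay: the powers of `R(z₀)` turn into powers of `(z₀ -
w)⁻¹` under the integral. -/
theorem rieszProjection_resolvent_pow_apply {z₀ : ℂ} (hr : 0 < r)
    (hiso : ∀ z ∈ closedBall c r, z ≠ c → z ∈ resolventSet A) (h₀ : z₀ ∈ resolventSet A)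
    (hz₀ : z₀ ∉ closedBall c r) (y : E) (m : ℕ) :
    rieszProjection A c r ((resolvent A z₀ ^ m) y)
      = (2 * (π : ℂ) * Complex.I)⁻¹ •
        ∮ w in C(c, r), ((z₀ - w)⁻¹ ^ m) • resolvent A w y := by
  obtain ⟨h, hd, hh⟩ := exists_resolvent_resolvent_pow_eq h₀ y m
  have hne : ∀ w ∈ closedBall c r, w ≠ z₀ := by
    rintro w hw rfl
    exact hz₀ hw
  have hint : CircleIntegrable (fun w => ((z₀ - w)⁻¹ ^ m) • resolvent A w y) c r := by
    refine ContinuousOn.circleIntegrable hr.le (ContinuousOn.smul ?_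
      ((continuousOn_resolvent_sphere hr.ne' hiso).clm_apply continuousOn_const))
    refine ((continuousOn_const.sub continuousOn_id).inv₀ fun w hw => ?_).pow m
    exact sub_ne_zero.2 (hne w (sphere_subset_closedBall hw)).symm
  have hhc : ContinuousOn h (closedBall c r) := fun w hw =>
    (hd w (hne w hw)).continuousAt.continuousWithinAt
  have h0 : (∮ w in C(c, r), h w) = 0 :=
    Complex.circleIntegral_eq_zero_of_differentiable_on_off_countable hr.le countable_empty hhc
      fun w hw => hd w (hne w (ball_subset_closedBall hw.1))
  rw [rieszProjection_apply hr hiso, circleIntegral.integral_congr hr.le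
    (g := fun w => ((z₀ - w)⁻¹ ^ m) • resolvent A w y + h w), circleIntegral.integral_add hint
    ((hhc.mono sphere_subset_closedBall).circleIntegrable hr.le), h0, add_zero]
  intro w hw
  have hw' := sphere_subset_closedBall hw
  exact hh w (hiso w hw' (ne_of_mem_sphere hw hr.ne')) (hne w hw')

end Riesz

/-! ### Two-sided resolvent bounds, sums of projections, and completeness. -/

section GroupEstimates

open Metric Set

variable {E : Type*} [NormedAddCommGroup E] [NormedSpace ℂ E]
  {n : ℕ} {A : E →ₗ.[ℂ] E} {S : ℝ → E →L[ℂ] E} {M : ℝ}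

theorem norm_neg_one_pow_smul_le (hM : ∀ t : ℝ, ‖S t‖ ≤ M * (1 + |t| ^ n)) (t : ℝ) (ht : 0 ≤ t) :
    ‖(-1 : ℂ) ^ n • S (-t)‖ ≤ M * (1 + t ^ n) := by
  rw [norm_smul]
  simpa [abs_of_nonneg ht] using hM (-t)

theorem mem_resolventSet_neg_of_re_pos (hρ : ∀ z : ℂ, z.re ≠ 0 → z ∈ resolventSet A) {z : ℂ}
    (hz : 0 < z.re) : z ∈ resolventSet (-A) := by
  have := neg_mem_resolventSet_neg (hρ (-z) (by simpa using hz.ne'))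
  rwa [neg_neg] at this

variable [CompleteSpace E]

theorem GeneratesIntegratedGroup.norm_resolvent_le (hS : GeneratesIntegratedGroup n A S)
    (hM : ∀ t : ℝ, ‖S t‖ ≤ M * (1 + |t| ^ n)) (hρ : ∀ z : ℂ, z.re ≠ 0 → z ∈ resolventSet A)
    {z : ℂ} (hz : z.re ≠ 0) (x : E) :
    ‖resolvent A z x‖
      ≤ M * ‖z‖ ^ n * (1 / |z.re| + n.factorial / |z.re| ^ (n + 1)) * ‖x‖ := by
  rcases hz.lt_or_gt with h | h
  · have h' : 0 < (-z).re := by simpa using h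
    have := hS.2.norm_resolvent_le (norm_neg_one_pow_smul_le hM)
      (fun z hz => mem_resolventSet_neg_of_re_pos hρ hz) h' x
    rw [resolvent_neg_neg (hρ z hz)] at this
    simpa [abs_of_neg h] using this
  · have := hS.1.norm_resolvent_le (fun t ht => by simpa [abs_of_nonneg ht] using hM t)
      (fun z hz => hρ z hz.ne') h x
    rwa [abs_of_pos h]

theorem GeneratesIntegratedGroup.norm_sum_smul_resolvent_le {ι : Type*} {F : Finset ι}
    {ω : ι → ℝ} {a r : ℝ} (hS : GeneratesIntegratedGroup n A S)
    (hM : ∀ t : ℝ, ‖S t‖ ≤ M * (1 + |t| ^ n)) (hρ : ∀ z : ℂ, z.re ≠ 0 → z ∈ resolventSet A)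
    (ha : a ≠ 0) (har : |a| ≤ r) (ha1 : |a| ≤ 1)
    (hω : ∀ j ∈ F, ∀ k ∈ F, j ≠ k → r ≤ |ω j - ω k|) (c : ι → ℂ) (y : E) {D : ℝ} (hD : 0 < D)
    (hc : ∑ k ∈ F, ‖c k * (a + Complex.I * ω k) ^ n‖ ^ 2 ≤ D ^ 2) :
    ‖∑ k ∈ F, c k • resolvent A (a + Complex.I * ω k) y‖ * |a| ^ (n + 1)
      ≤ M * (1 + (2 * n).factorial + separationConst) * D * ‖y‖ := by
  rcases ha.lt_or_gt with h | h
  -- The left half-plane is reduced to the right one for `-A`, through `R(z, A) = -R(-z, -A)`; the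
  -- frequencies change sign and stay separated.
  · have hz : ∀ k, ((-a : ℝ) : ℂ) + Complex.I * ((-ω k : ℝ) : ℂ)
        = -((a : ℂ) + Complex.I * ω k) := by
      intro k
      push_cast
      ring
    rw [abs_of_neg h] at har ha1 ⊢
    have := hS.2.norm_sum_smul_resolvent_le (F := F) (ω := fun k => -ω k) (a := -a) (r := r)
      (norm_neg_one_pow_smul_le hM) (fun z hz => mem_resolventSet_neg_of_re_pos hρ hz)
      (neg_pos.2 h) har ha1 (fun j hj k hk hjk => by
        rw [neg_sub_neg, abs_sub_comm]
        exact hω j hj k hk hjk) c y hD (by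
        have hn : ∀ k, ‖c k * (-((a : ℂ) + Complex.I * ω k)) ^ n‖
            = ‖c k * ((a : ℂ) + Complex.I * ω k) ^ n‖ := fun k => by
          rw [norm_mul, norm_mul, norm_pow, norm_pow, norm_neg]
        simp_rw [hz, hn]
        exact hc)
    simp_rw [hz] at this
    have h2 : ∀ k, resolvent (-A) (-((a : ℂ) + Complex.I * ω k))
        = -resolvent A (a + Complex.I * ω k) := fun k =>
      resolvent_neg_neg (hρ _ (by simpa using ha))
    simp_rw [h2, neg_apply, smul_neg, Finset.sum_neg_distrib, norm_neg] at this
    exact this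
  · rw [abs_of_pos h] at har ha1 ⊢
    exact hS.1.norm_sum_smul_resolvent_le (fun t ht => by simpa [abs_of_nonneg ht] using hM t)
      (fun z hz => hρ z hz.ne') h har ha1 hω c y hD hc

/-- The real part bounds the modulus below by `1` and the imaginary part by `|μ| - 1`; the average
of the two is `|μ| / 2`. -/
theorem half_abs_le_norm_two_sub {μ : ℝ} {ζ : ℂ} (hζ : ‖ζ‖ ≤ 1) :
    |μ| / 2 ≤ ‖2 - (Complex.I * μ + ζ)‖ := by
  have hre := (Complex.abs_re_le_norm ζ).trans hζ
  have him := (Complex.abs_im_le_norm ζ).trans hζ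
  have h1 : 1 ≤ ‖2 - (Complex.I * μ + ζ)‖ := by
    refine le_trans ?_ (Complex.abs_re_le_norm _)
    have : (2 - (Complex.I * μ + ζ)).re = 2 - ζ.re := by simp
    rw [this]
    exact le_trans (by linarith [le_abs_self ζ.re]) (le_abs_self _)
  have h2 : |μ| - 1 ≤ ‖2 - (Complex.I * μ + ζ)‖ := by
    refine le_trans ?_ (Complex.abs_im_le_norm _)
    have : (2 - (Complex.I * μ + ζ)).im = -(μ + ζ.im) := by simp
    rw [this, abs_neg]
    have := abs_sub_abs_le_abs_sub μ (-ζ.im)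
    rw [abs_neg, sub_neg_eq_add] at this
    linarith
  linarith

theorem norm_I_mul_add_le {μ κ : ℝ} {ζ : ℂ} (hζ : ‖ζ‖ ≤ 1) (hκ : 0 < κ) (hμ : κ ≤ |μ|) :
    ‖Complex.I * μ + ζ‖ ≤ (1 + 1 / κ) * |μ| := by
  have h1 : 1 ≤ 1 / κ * |μ| := by
    rw [one_div, ← div_eq_inv_mul, le_div_iff₀ hκ]
    linarith
  calc _ ≤ ‖Complex.I * μ‖ + ‖ζ‖ := norm_add_le _ _
    _ = |μ| + ‖ζ‖ := by simp
    _ ≤ _ := by linarith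

/-- The constant in `GeneratesIntegratedGroup.norm_sum_rieszProjection_le`. -/
def projectionConst (n l : ℕ) (M κ : ℝ) : ℝ :=
  M * (1 + (2 * n).factorial + separationConst) * (2 ^ (n + l) * (1 + 1 / κ) ^ n) * (5 * 10 ^ n)

/-- Square-sum estimate for finite sums of spectral projections at `r`-separated points
`i μ_k` of the spectrum. -/
theorem GeneratesIntegratedGroup.norm_sum_rieszProjection_le {ι : Type*} {F : Finset ι}
    {μ : ι → ℝ} {r κ : ℝ} (l : ℕ) (hS : GeneratesIntegratedGroup n A S)
    (hM : ∀ t : ℝ, ‖S t‖ ≤ M * (1 + |t| ^ n)) (hρ : ∀ z : ℂ, z.re ≠ 0 → z ∈ resolventSet A)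
    (hr : 0 < r) (hr1 : r ≤ 1) (hκ : 0 < κ) (hμ : ∀ k ∈ F, κ ≤ |μ k|)
    (hsep : ∀ j ∈ F, ∀ k ∈ F, j ≠ k → r ≤ |μ j - μ k|)
    (hiso : ∀ k ∈ F, ∀ z ∈ ball (Complex.I * μ k) r, z ≠ Complex.I * μ k → z ∈ resolventSet A)
    (y : E) {Q : ℝ} (hQ : 0 < Q) (hsum : ∑ k ∈ F, (1 / |μ k| ^ l) ^ 2 ≤ Q ^ 2) :
    ‖∑ k ∈ F, rieszProjection A (Complex.I * μ k) (r / 2) ((resolvent A 2 ^ (n + l)) y)‖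
      ≤ projectionConst n l M κ * (Q / r ^ n) * ‖y‖ := by
  have hr2 : 0 < r / 2 := by positivity
  have hM0 : 0 ≤ M := by
    have := (norm_nonneg _).trans (hM 0)
    have h0 : (0 : ℝ) < 1 + |0| ^ n := by positivity
    exact nonneg_of_mul_nonneg_left this h0
  -- Translating every circle to the origin merges the projections into one contour integral, so the
  -- square-sum estimate can be applied before any triangle inequality over `k`.
  set f : ℂ → E := fun ζ => ∑ k ∈ F, ((2 - (Complex.I * μ k + ζ))⁻¹ ^ (n + l)) •
    resolvent A (Complex.I * μ k + ζ) y with hf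
  have hpos : ∀ k ∈ F, ∀ ζ : ℂ, ‖ζ‖ ≤ 1 → 0 < ‖2 - (Complex.I * μ k + ζ)‖ := fun k hk ζ hζ =>
    lt_of_lt_of_le (by linarith [hμ k hk]) (half_abs_le_norm_two_sub (μ := μ k) hζ)
  have hiso' : ∀ k ∈ F, ∀ z ∈ closedBall (Complex.I * μ k) (r / 2), z ≠ Complex.I * μ k →
      z ∈ resolventSet A := fun k hk z hz =>
    hiso k hk z (closedBall_subset_ball (by linarith) hz)
  have hdiff : ∀ k ∈ F, ∀ ζ ∈ ball (0 : ℂ) r, ζ ≠ 0 → DifferentiableAt ℂ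
      (fun ζ => ((2 - (Complex.I * μ k + ζ))⁻¹ ^ (n + l)) •
        resolvent A (Complex.I * μ k + ζ) y) ζ := by
    intro k hk ζ hζ hne
    have hζr : ‖ζ‖ < r := by simpa using hζ
    have h1 : DifferentiableAt ℂ (fun ζ : ℂ => 2 - (Complex.I * μ k + ζ)) ζ := by fun_prop
    refine ((h1.inv (norm_pos_iff.1 (hpos k hk ζ (by linarith)))).pow _).smul ?_
    refine DifferentiableAt.comp (g := fun w => resolvent A w y) ζ
      (differentiableAt_resolvent_apply (hiso k hk _ (by simpa using hζr) (by simpa using hne)) y)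
      (by fun_prop)
  have hsumeq : ∑ k ∈ F, rieszProjection A (Complex.I * μ k) (r / 2)
      ((resolvent A 2 ^ (n + l)) y) = (2 * (π : ℂ) * Complex.I)⁻¹ • ∮ ζ in C(0, r / 2), f ζ := by
    rw [hf, circleIntegral.integral_fun_sum, Finset.smul_sum]
    · refine Finset.sum_congr rfl fun k hk => ?_
      rw [rieszProjection_resolvent_pow_apply hr2 (hiso' k hk) (hρ 2 (by simp)),
        circleIntegral_eq_zero_center]
      intro hmem
      have := hpos k hk (2 - Complex.I * μ k) (by
        rw [mem_closedBall, dist_eq_norm] at hmem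
        linarith)
      simp at this
    · intro k hk
      refine ContinuousOn.circleIntegrable hr2.le fun ζ hζ => ?_
      refine (hdiff k hk ζ ?_ (ne_of_mem_sphere hζ hr2.ne')).continuousAt.continuousWithinAt
      exact closedBall_subset_ball (by linarith) (sphere_subset_closedBall hζ)
  -- Bounds the `ℓ²` norm of `(2 - z_k)^(-(n+l)) z_k^n` with `z_k = i μ_k + ζ`: each term is at most
  -- a constant times `|μ_k|^(-l)`.
  set D : ℝ := 2 ^ (n + l) * (1 + 1 / κ) ^ n * Q with hD
  have hD0 : 0 < D := by positivity
  set B : ℝ := M * (1 + (2 * n).factorial + separationConst) * D * ‖y‖ with hB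
  have hB0 : 0 ≤ B := by
    have := separationConst_nonneg
    positivity
  have hbound : ∀ ζ ∈ ball (0 : ℂ) (2 * (r / 2)), ζ.re ≠ 0 → ‖f ζ‖ * |ζ.re| ^ (n + 1) ≤ B := by
    intro ζ hζ hre
    have hζr : ‖ζ‖ < r := by
      rw [mem_ball_zero_iff] at hζ
      linarith
    have hζ1 : ‖ζ‖ ≤ 1 := by linarith
    have har := Complex.abs_re_le_norm ζ
    have hz : ∀ k, Complex.I * μ k + ζ = (ζ.re : ℂ) + Complex.I * ((μ k + ζ.im : ℝ) : ℂ) := by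
      intro k
      apply Complex.ext <;> simp
    have key := hS.norm_sum_smul_resolvent_le (F := F) (ω := fun k => μ k + ζ.im) (a := ζ.re)
      (r := r) hM hρ hre (by linarith) (by linarith)
      (fun j hj k hk hjk => by
        rw [add_sub_add_right_eq_sub]
        exact hsep j hj k hk hjk)
      (fun k => (2 - (Complex.I * μ k + ζ))⁻¹ ^ (n + l)) y hD0 ?_
    · simp_rw [← hz] at key
      exact key
    · simp_rw [← hz]
      have hterm : ∀ k ∈ F, ‖(2 - (Complex.I * μ k + ζ))⁻¹ ^ (n + l) * (Complex.I * μ k + ζ) ^ n‖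
          ≤ 2 ^ (n + l) * (1 + 1 / κ) ^ n * (1 / |μ k| ^ l) := by
        intro k hk
        have hμ0 : 0 < |μ k| := hκ.trans_le (hμ k hk)
        rw [norm_mul, norm_pow, norm_pow, norm_inv]
        calc _ ≤ (|μ k| / 2)⁻¹ ^ (n + l) * ((1 + 1 / κ) * |μ k|) ^ n := by
              gcongr
              · exact half_abs_le_norm_two_sub hζ1
              · exact norm_I_mul_add_le hζ1 hκ (hμ k hk)
          _ = _ := by
              rw [inv_div, div_pow, mul_pow, pow_add |μ k|]
              field_simp
      calc _ ≤ ∑ k ∈ F, (2 ^ (n + l) * (1 + 1 / κ) ^ n * (1 / |μ k| ^ l)) ^ 2 :=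
            Finset.sum_le_sum fun k hk => pow_le_pow_left₀ (norm_nonneg _) (hterm k hk) 2
        _ = (2 ^ (n + l) * (1 + 1 / κ) ^ n) ^ 2 * ∑ k ∈ F, (1 / |μ k| ^ l) ^ 2 := by
            rw [Finset.mul_sum]
            exact Finset.sum_congr rfl fun k _ => mul_pow _ _ _
        _ ≤ (2 ^ (n + l) * (1 + 1 / κ) ^ n) ^ 2 * Q ^ 2 := by gcongr
        _ = D ^ 2 := by rw [hD, ← mul_pow]
  -- The factor here is `(10/r)^(n+1)`. The normalised contour integral multiplies it by the radius
  -- `r/2`, leaving `5 · 10^n / r^n`.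
  have hsphere : ∀ ζ ∈ sphere (0 : ℂ) (r / 2), ‖f ζ‖ ≤ B * (5 / (r / 2)) ^ (n + 1) := by
    intro ζ hζ
    refine norm_le_on_sphere_of_norm_mul_re_pow_le n.succ_ne_zero hr2 (fun z hz hne => ?_) hB0
      hbound (by simpa using hζ)
    refine DifferentiableAt.fun_sum fun k hk => hdiff k hk z ?_ hne
    rwa [mul_div_cancel₀ r two_ne_zero] at hz
  rw [hsumeq]
  refine (circleIntegral.norm_two_pi_i_inv_smul_integral_le_of_norm_le_const hr2.le
    hsphere).trans_eq ?_
  rw [hB, hD, projectionConst, div_div_eq_mul_div, div_pow, pow_succ, pow_succ]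
  field_simp
  ring

/-- A vector killed by all spectral projections vanishes, if the resolvent is controlled by a
polynomially bounded integrated group and the spectrum is isolated on the imaginary axis. -/
theorem GeneratesIntegratedGroup.eq_zero_of_rieszProjection_eq_zero
    (hS : GeneratesIntegratedGroup n A S) (hM : ∀ t : ℝ, ‖S t‖ ≤ M * (1 + |t| ^ n))
    (hρ : ∀ z : ℂ, z.re ≠ 0 → z ∈ resolventSet A) {v : E}
    (hv : ∀ c ∉ resolventSet A, ∃ r > 0,
      (∀ z ∈ closedBall c r, z ≠ c → z ∈ resolventSet A) ∧ rieszProjection A c r v = 0) :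
    v = 0 := by
  have hM0 : 0 ≤ M := by
    have := (norm_nonneg _).trans (hM 0)
    have h0 : (0 : ℝ) < 1 + |0| ^ n := by positivity
    exact nonneg_of_mul_nonneg_left this h0
  obtain ⟨F, hF, hFR⟩ := exists_entire_extension (f := fun z => resolvent A z v) fun p => by
    by_cases hp : p ∈ resolventSet A
    · refine ⟨fun z => resolvent A z v, ?_, Filter.EventuallyEq.rfl⟩
      filter_upwards [(isOpen_resolventSet A).mem_nhds hp] with z hz
      exact differentiableAt_resolvent_apply hz v
    · obtain ⟨r, hr, hiso, h0⟩ := hv p hp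
      exact exists_extension_of_rieszProjection_eq_zero hr hiso h0
  have hFR' : ∀ z ∈ resolventSet A, F z = resolvent A z v := fun z hz =>
    hFR z (differentiableAt_resolvent_apply hz v).continuousAt
  -- The first summand of the growth constant serves `|Re z| ≥ 1/2`, where the resolvent bound is
  -- direct; the second serves the strip around the axis.
  refine eq_zero_of_entire_resolvent (hρ 1 (by simp)) (hρ 2 (by simp)) (by norm_num) n v F hF
    hFR' ⟨M * (2 + n.factorial * 2 ^ (n + 1)) * ‖v‖
      + M * (1 + n.factorial) * ‖v‖ * 2 ^ (n + 1) * (4 / 3) ^ (n + 1), fun z => ?_⟩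
  rw [add_mul]
  by_cases hz : 1 / 2 ≤ |z.re|
  · have hz0 : z.re ≠ 0 := by
      intro h
      rw [h, abs_zero] at hz
      norm_num at hz
    have hinv : 1 / |z.re| ≤ 2 := by
      rw [div_le_iff₀ (abs_pos.2 hz0)]
      linarith
    refine le_add_of_le_of_nonneg ?_ (by positivity)
    rw [hFR' z (hρ z hz0)]
    refine (hS.norm_resolvent_le hM hρ hz0 v).trans ?_
    have h2 : (n.factorial : ℝ) / |z.re| ^ (n + 1) ≤ n.factorial * 2 ^ (n + 1) := by
      rw [div_eq_mul_one_div, ← one_div_pow]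
      gcongr
    calc _ ≤ M * (1 + ‖z‖) ^ n * (2 + n.factorial * 2 ^ (n + 1)) * ‖v‖ := by
          gcongr
          linarith
      _ = _ := by ring
  · push Not at hz
    refine le_add_of_nonneg_of_le (by positivity) ?_
    set c : ℂ := (z.im : ℂ) * Complex.I with hc
    have hcre : c.re = 0 := by simp [hc]
    have hcn : ‖c‖ ≤ ‖z‖ := by
      simpa [hc] using Complex.abs_im_le_norm z
    have hzc : z - c = (z.re : ℂ) := by
      apply Complex.ext <;> simp [hc]
    have hznorm : ‖z - c‖ = |z.re| := by
      rw [hzc, Complex.norm_real, Real.norm_eq_abs]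
    -- The unit disc about `i Im z` is allowed to contain spectrum, since `F` is entire. On its
    -- boundary `‖u‖ ≤ 1 + ‖z‖`, which keeps the growth of degree `n`.
    have key := norm_le_of_norm_mul_re_pow_le (f := F) (c := c) (s := 1) (N := n + 1) (z := z)
      (B := M * (1 + ‖z‖) ^ n * (1 + n.factorial) * ‖v‖) n.succ_ne_zero one_pos hF.diffContOnCl
      (by positivity) ?_ ?_
    · have h3 : ‖F z‖ * (3 / 4) ^ (n + 1)
          ≤ M * (1 + ‖z‖) ^ n * (1 + n.factorial) * ‖v‖ * 2 ^ (n + 1) := by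
        rw [mul_one] at key
        refine le_trans ?_ key
        gcongr
        rw [hznorm, sq_abs, one_pow]
        nlinarith [abs_lt.1 hz]
      rw [← le_div_iff₀ (by positivity)] at h3
      refine h3.trans_eq ?_
      rw [div_eq_mul_inv, ← inv_pow, inv_div]
      ring
    · intro u hu hure
      have hu1 : ‖u - c‖ = 1 := by simpa [dist_eq_norm] using hu
      have hure1 : |(u - c).re| ≤ 1 := hu1 ▸ Complex.abs_re_le_norm _
      have hre : (u - c).re = u.re := by simp [hcre]
      rw [hre] at hure hure1 ⊢
      have hun : ‖u‖ ≤ 1 + ‖z‖ := by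
        have := norm_add_le (u - c) c
        rw [sub_add_cancel, hu1] at this
        linarith
      have hp : 0 < |u.re| := abs_pos.2 hure
      rw [hFR' u (hρ u hure)]
      have h4 := hS.norm_resolvent_le hM hρ hure v
      have h5 : (1 / |u.re| + n.factorial / |u.re| ^ (n + 1)) * |u.re| ^ (n + 1)
          ≤ 1 + n.factorial := by
        rw [add_mul, div_mul_cancel₀ _ (by positivity), pow_succ', ← mul_assoc,
          one_div_mul_cancel hp.ne', one_mul]
        have := pow_le_one₀ (n := n) hp.le hure1
        linarith
      calc _ ≤ M * ‖u‖ ^ n * (1 / |u.re| + n.factorial / |u.re| ^ (n + 1)) * ‖v‖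
            * |u.re| ^ (n + 1) := by gcongr
        _ = M * ‖u‖ ^ n * ((1 / |u.re| + n.factorial / |u.re| ^ (n + 1)) * |u.re| ^ (n + 1))
            * ‖v‖ := by ring
        _ ≤ M * (1 + ‖z‖) ^ n * (1 + n.factorial) * ‖v‖ := by gcongr
    · rw [mem_closedBall, dist_eq_norm, hznorm]
      linarith

end GroupEstimates

/-! ### Order on nonzero integers and separation of the spectral points. -/

section HalfGap

open Metric Set

theorem NZInt.lt_next (k : NZInt) : k < k.next := by
  rw [← Subtype.coe_lt_coe, NZInt.next]
  split_ifs with h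
  · simp
    omega
  · simp

theorem NZInt.prev_lt (k : NZInt) : k.prev < k := by
  rw [← Subtype.coe_lt_coe, NZInt.prev]
  split_ifs with h
  · simp
    omega
  · simp

theorem NZInt.next_le {k j : NZInt} (h : k < j) : k.next ≤ j := by
  have hj := j.2
  rw [← Subtype.coe_lt_coe] at h
  rw [← Subtype.coe_le_coe, NZInt.next]
  split_ifs with h' <;> (simp; omega)

theorem NZInt.le_prev {k j : NZInt} (h : j < k) : j ≤ k.prev := by
  have hj := j.2
  rw [← Subtype.coe_lt_coe] at h
  rw [← Subtype.coe_le_coe, NZInt.prev]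
  split_ifs with h' <;> (simp; omega)

variable {lam : NZInt → ℝ}

theorem halfGap_pos (hmono : StrictMono lam) (k : NZInt) : 0 < halfGap lam k := by
  have h1 := hmono k.lt_next
  have h2 := hmono k.prev_lt
  refine lt_min (half_pos (abs_pos.2 ?_)) (half_pos (abs_pos.2 ?_)) <;> intro h <;> linarith

theorem two_mul_halfGap_le (hmono : StrictMono lam) {j k : NZInt} (hjk : j ≠ k) :
    2 * halfGap lam k ≤ |lam j - lam k| := by
  rcases hjk.lt_or_gt with h | h
  · have h1 := hmono.monotone (NZInt.le_prev h)
    have h2 := hmono k.prev_lt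
    have h3 : halfGap lam k ≤ |lam k.prev - lam k| / 2 := min_le_right _ _
    rw [abs_of_neg (by linarith)] at h3
    rw [abs_of_neg (by linarith)]
    linarith
  · have h1 := hmono.monotone (NZInt.next_le h)
    have h2 := hmono k.lt_next
    have h3 : halfGap lam k ≤ |lam k.next - lam k| / 2 := min_le_left _ _
    rw [abs_of_pos (by linarith)] at h3
    rw [abs_of_pos (by linarith)]
    linarith

theorem exists_pos_le_abs (hmono : StrictMono lam)
    (hpos : ∀ k : NZInt, 0 < k.1 → 0 < lam k) (hneg : ∀ k : NZInt, k.1 < 0 → lam k < 0) :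
    ∃ κ > 0, ∀ k, κ ≤ |lam k| := by
  have h1 := hpos ⟨1, one_ne_zero⟩ one_pos
  have h2 := hneg ⟨-1, by decide⟩ (by decide)
  refine ⟨min (lam ⟨1, one_ne_zero⟩) (-lam ⟨-1, by decide⟩), lt_min h1 (neg_pos.2 h2),
    fun k => ?_⟩
  rcases k.2.lt_or_gt with h | h
  · rw [abs_of_neg (hneg k h)]
    refine (min_le_right _ _).trans (neg_le_neg (hmono.monotone ?_))
    rw [← Subtype.coe_le_coe]
    change k.1 ≤ -1
    omega
  · rw [abs_of_pos (hpos k h)]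
    refine (min_le_left _ _).trans (hmono.monotone ?_)
    rw [← Subtype.coe_le_coe]
    change 1 ≤ k.1
    omega

theorem norm_I_mul_sub_I_mul (a b : ℝ) :
    ‖Complex.I * (a : ℂ) - Complex.I * (b : ℂ)‖ = |a - b| := by
  rw [← mul_sub, norm_mul, Complex.norm_I, one_mul, ← Complex.ofReal_sub, Complex.norm_real,
    Real.norm_eq_abs]

/-- Separation makes the integer parts distinct, so `∑ 1/(1 + m²)` over the integers dominates. The
lower bound `κ` absorbs the powers beyond the square. -/
theorem summable_one_div_abs_pow_sq_of_separated {ι : Type*} {μ : ι → ℝ} {κ : ℝ} {l : ℕ}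
    (hl : 1 ≤ l) (hκ : 0 < κ) (hμ : ∀ k, κ ≤ |μ k|) (hsep : ∀ j k, j ≠ k → 1 ≤ |μ j - μ k|) :
    Summable fun k => (1 / |μ k| ^ l) ^ 2 := by
  have hinj : Function.Injective fun k => ⌊μ k⌋ := by
    rw [← injOn_univ]
    exact floor_injOn_of_separated fun j _ k _ hjk => hsep j k hjk
  refine Summable.of_nonneg_of_le (fun k => by positivity) (fun k => ?_)
    ((summable_three_div_one_add_sq.comp_injective hinj).mul_left
      ((1 / κ ^ (l - 1)) ^ 2 * (1 + 1 / κ ^ 2)))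
  have h0 : 0 < |μ k| := hκ.trans_le (hμ k)
  have h1 : 1 / |μ k| ^ 2 ≤ (1 + 1 / κ ^ 2) * (1 / (1 + μ k ^ 2)) := by
    rw [mul_one_div, div_le_div_iff₀ (by positivity) (by positivity), sq_abs]
    have : 1 ≤ 1 / κ ^ 2 * μ k ^ 2 := by
      rw [one_div, ← div_eq_inv_mul, le_div_iff₀ (by positivity), one_mul, ← sq_abs (μ k)]
      exact pow_le_pow_left₀ hκ.le (hμ k) 2
    linarith
  calc (1 / |μ k| ^ l) ^ 2 = (1 / |μ k| ^ (l - 1)) ^ 2 * (1 / |μ k| ^ 2) := by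
        obtain ⟨m, rfl⟩ := Nat.exists_eq_add_of_le hl
        rw [Nat.add_sub_cancel_left, pow_add]
        field_simp
    _ ≤ (1 / κ ^ (l - 1)) ^ 2 * ((1 + 1 / κ ^ 2) * (3 / (1 + (⌊μ k⌋ : ℝ) ^ 2))) := by
        gcongr
        · exact hμ k
        · refine h1.trans ?_
          gcongr ?_ * ?_
          exact one_div_one_add_sq_le_floor _
    _ = _ := by
        simp only [Function.comp]
        ring

end HalfGap

/-! ### Convergence and identification of the sum. -/

section Expansion

open Metric Set

variable {E : Type*} [NormedAddCommGroup E] [NormedSpace ℂ E]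
  {n l : ℕ} {A : E →ₗ.[ℂ] E} {S : ℝ → E →L[ℂ] E} {M : ℝ} {lam : NZInt → ℝ}

theorem mem_resolventSet_of_re_ne_zero
    (hspec : spectrum A = range fun k : NZInt => Complex.I * (lam k : ℂ)) {z : ℂ}
    (hz : z.re ≠ 0) : z ∈ resolventSet A := by
  by_contra h
  have h' : z ∈ spectrum A := h
  rw [hspec] at h'
  obtain ⟨k, rfl⟩ := h'
  simp at hz

theorem mem_resolventSet_of_mem_ball (hmono : StrictMono lam)
    (hspec : spectrum A = range fun k : NZInt => Complex.I * (lam k : ℂ)) {k : NZInt} {r : ℝ}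
    (hr : r ≤ 2 * halfGap lam k) {z : ℂ} (hz : z ∈ ball (Complex.I * (lam k : ℂ)) r)
    (hne : z ≠ Complex.I * (lam k : ℂ)) : z ∈ resolventSet A := by
  by_contra h
  have h' : z ∈ spectrum A := h
  rw [hspec] at h'
  obtain ⟨j, rfl⟩ := h'
  have hjk : j ≠ k := by
    rintro rfl
    exact hne rfl
  rw [mem_ball, dist_eq_norm, norm_I_mul_sub_I_mul] at hz
  linarith [two_mul_halfGap_le hmono hjk]

variable [CompleteSpace E]

theorem GeneratesIntegratedGroup.summable_rieszProjection (hl : 1 ≤ l)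
    (hS : GeneratesIntegratedGroup n A S) (hM : ∀ t : ℝ, ‖S t‖ ≤ M * (1 + |t| ^ n))
    (hmono : StrictMono lam) {κ : ℝ} (hκ : 0 < κ) (hlam : ∀ k, κ ≤ |lam k|)
    (hspec : spectrum A = range fun k : NZInt => Complex.I * (lam k : ℂ))
    (hsum : Summable fun k : NZInt => 1 / (|lam k| ^ l * halfGap lam k ^ n)) (y : E)
    {P : NZInt → E →L[ℂ] E}
    (hP : ∀ k, ∀ r > 0, r ≤ halfGap lam k →
      P k = rieszProjection A (Complex.I * (lam k : ℂ)) (r / 2)) :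
    Summable fun k => P k ((resolvent A 2 ^ (n + l)) y) := by
  have hρ : ∀ z : ℂ, z.re ≠ 0 → z ∈ resolventSet A := fun z hz =>
    mem_resolventSet_of_re_ne_zero hspec hz
  have key : ∀ (F : Finset NZInt) (r : ℝ), 0 < r → r ≤ 1 → (∀ k ∈ F, r ≤ halfGap lam k) →
      ∀ Q : ℝ, 0 < Q → ∑ k ∈ F, (1 / |lam k| ^ l) ^ 2 ≤ Q ^ 2 →
      ‖∑ k ∈ F, P k ((resolvent A 2 ^ (n + l)) y)‖
        ≤ projectionConst n l M κ * (Q / r ^ n) * ‖y‖ := by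
    intro F r hr hr1 hF Q hQ hFQ
    rw [Finset.sum_congr rfl fun k hk => by rw [hP k r hr (hF k hk)]]
    refine hS.norm_sum_rieszProjection_le l hM hρ hr hr1 hκ (fun k _ => hlam k)
      (fun j hj k hk hjk => ?_) (fun k hk z hz hne => ?_) y hQ hFQ
    · linarith [two_mul_halfGap_le hmono hjk, hF k hk]
    · exact mem_resolventSet_of_mem_ball hmono hspec (by linarith [hF k hk]) hz hne
  -- The radius parameter `r` is capped at `1`. On `G` it equals `1` and the square-sum estimate is
  -- needed; off `G` it equals the half-gap and each term is bounded separately by the summable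
  -- hypothesis.
  set G : Set NZInt := {k | 1 ≤ halfGap lam k}
  rw [← summable_subtype_and_compl (s := G)]
  constructor
  · have hG : Summable fun k : G => (1 / |lam k| ^ l) ^ 2 :=
      summable_one_div_abs_pow_sq_of_separated hl hκ (fun k => hlam k) fun j k hjk => by
        have h1 := two_mul_halfGap_le hmono (fun h => hjk (Subtype.ext h) : (j : NZInt) ≠ k)
        have h2 : 1 ≤ halfGap lam k := k.2
        linarith
    rw [summable_iff_vanishing_norm] at hG ⊢
    intro ε hε
    set C := |projectionConst n l M κ * ‖y‖|
    -- A tail of `∑ |λ_k|^(-2l)` below `Q²` bounds the corresponding sum of projections by `C Q`.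
    -- The extra `1` allows `C = 0` and makes the final inequality strict.
    have hQ : 0 < ε / (C + 1) := by positivity
    obtain ⟨s, hs⟩ := hG ((ε / (C + 1)) ^ 2) (by positivity)
    refine ⟨s, fun t ht => ?_⟩
    have h1 := (le_abs_self _).trans (hs t ht).le
    have h2 := key (t.map (Function.Embedding.subtype _)) 1 one_pos le_rfl (by
      intro k hk
      obtain ⟨a, _, rfl⟩ := Finset.mem_map.1 hk
      exact a.2) (ε / (C + 1)) hQ (by
      rw [Finset.sum_map]
      exact h1)
    rw [Finset.sum_map] at h2
    refine lt_of_le_of_lt h2 ?_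
    calc projectionConst n l M κ * (ε / (C + 1) / 1 ^ n) * ‖y‖
        = projectionConst n l M κ * ‖y‖ * (ε / (C + 1)) := by rw [one_pow]; ring
      _ ≤ C * (ε / (C + 1)) := by
        gcongr
        exact le_abs_self _
      _ < (C + 1) * (ε / (C + 1)) := by
        gcongr
        linarith
      _ = ε := by
        have hC : C + 1 ≠ 0 := by positivity
        field_simp
  · refine Summable.of_norm_bounded
      (g := fun k : (Gᶜ : Set NZInt) => projectionConst n l M κ * ‖y‖ *
        (1 / (|lam k| ^ l * halfGap lam k ^ n)))
      ((hsum.subtype _).mul_left _) fun k => ?_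
    have hk : halfGap lam k < 1 := not_le.1 k.2
    have h0 : 0 < |lam k| := hκ.trans_le (hlam k)
    have h2 := key {(k : NZInt)} (halfGap lam k) (halfGap_pos hmono _) hk.le
      (fun j hj => by rw [Finset.mem_singleton.1 hj]) (1 / |lam k| ^ l) (by positivity)
      (by rw [Finset.sum_singleton])
    rw [Finset.sum_singleton] at h2
    refine h2.trans_eq ?_
    rw [div_div]
    ring

theorem GeneratesIntegratedGroup.hasSum_rieszProjection (hl : 1 ≤ l)
    (hS : GeneratesIntegratedGroup n A S) (hM : ∀ t : ℝ, ‖S t‖ ≤ M * (1 + |t| ^ n))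
    (hmono : StrictMono lam)
    (hpos : ∀ k : NZInt, 0 < k.1 → 0 < lam k) (hneg : ∀ k : NZInt, k.1 < 0 → lam k < 0)
    (hspec : spectrum A = range fun k : NZInt => Complex.I * (lam k : ℂ))
    (hsum : Summable fun k : NZInt => 1 / (|lam k| ^ l * halfGap lam k ^ n))
    {ε : NZInt → ℝ} (hε : ∀ k, 0 < ε k)
    (hball : ∀ k, closedBall (Complex.I * (lam k : ℂ)) (ε k) ∩ spectrum A
      = {Complex.I * (lam k : ℂ)})
    {x : E} (hx : x ∈ powDomain A (n + l)) :
    HasSum (fun k : NZInt => rieszProjection A (Complex.I * (lam k : ℂ)) (ε k) x) x := by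
  have hρ : ∀ z : ℂ, z.re ≠ 0 → z ∈ resolventSet A := fun z hz =>
    mem_resolventSet_of_re_ne_zero hspec hz
  obtain ⟨κ, hκ, hlam⟩ := exists_pos_le_abs hmono hpos hneg
  have hisoε : ∀ k, ∀ z ∈ closedBall (Complex.I * (lam k : ℂ)) (ε k),
      z ≠ Complex.I * (lam k : ℂ) → z ∈ resolventSet A := by
    intro k z hz hne
    by_contra h
    have h' : z ∈ closedBall (Complex.I * (lam k : ℂ)) (ε k) ∩ spectrum A := ⟨hz, h⟩
    rw [hball k] at h'
    exact hne h'
  have hisoδ : ∀ k, ∀ r, r ≤ halfGap lam k → ∀ z ∈ closedBall (Complex.I * (lam k : ℂ)) (r / 2),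
      z ≠ Complex.I * (lam k : ℂ) → z ∈ resolventSet A := fun k r hr z hz hne =>
    mem_resolventSet_of_mem_ball hmono hspec le_rfl
      (closedBall_subset_ball (by linarith [halfGap_pos hmono k]) hz) hne
  set P : NZInt → E →L[ℂ] E := fun k => rieszProjection A (Complex.I * (lam k : ℂ)) (ε k)
  have hP : ∀ k, ∀ r > 0, r ≤ halfGap lam k →
      P k = rieszProjection A (Complex.I * (lam k : ℂ)) (r / 2) := fun k r hr hrk =>
    rieszProjection_eq (hε k) (half_pos hr) (hisoε k) (hisoδ k r hrk)
  obtain ⟨y, rfl⟩ := exists_resolvent_pow_apply_eq (hρ 2 (by simp)) (n + l) x hx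
  set x := (resolvent A 2 ^ (n + l)) y
  obtain ⟨x', hx'⟩ := hS.summable_rieszProjection hl hM hmono hκ hlam hspec hsum y hP
  -- The series converges to some `x'`; completeness identifies it with `x`.
  suffices h : x - x' = 0 by rwa [← sub_eq_zero.1 h] at hx'
  have hPP : ∀ j, P j x' = P j x := by
    intro j
    have h1 : HasSum (fun k => P j (P k x)) (P j x') := hx'.mapL (P j)
    refine h1.unique ?_
    have h2 : P j (P j x) = P j x := rieszProjection_idem_apply (hε j) (hisoε j) x
    rw [← h2]
    refine hasSum_single j fun k hkj => ?_
    have hj := halfGap_pos hmono j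
    have hk := halfGap_pos hmono k
    -- The prescribed discs of radius `ε k` may overlap, so both projections are moved to radius
    -- half of the half-gap, where the closed discs are disjoint.
    rw [hP j _ hj le_rfl, hP k _ hk le_rfl]
    refine rieszProjection_apply_rieszProjection_eq_zero (half_pos hk) (half_pos hj)
      (hisoδ k _ le_rfl) (hisoδ j _ le_rfl) (fun z hz hz' => ?_) x
    have h3 := two_mul_halfGap_le hmono hkj
    have h4 := two_mul_halfGap_le hmono hkj.symm
    rw [abs_sub_comm] at h4
    rw [mem_closedBall] at hz hz'
    have h5 := dist_triangle_left (Complex.I * (lam k : ℂ)) (Complex.I * (lam j : ℂ)) z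
    rw [dist_eq_norm (Complex.I * (lam k : ℂ)), norm_I_mul_sub_I_mul] at h5
    linarith
  refine hS.eq_zero_of_rieszProjection_eq_zero hM hρ fun c hc => ?_
  have hc' : c ∈ spectrum A := hc
  rw [hspec] at hc'
  obtain ⟨k, rfl⟩ := hc'
  refine ⟨ε k, hε k, hisoε k, ?_⟩
  change P k (x - x') = 0
  rw [map_sub, hPP, sub_self]

end Expansion

end IntegratedGroup

end

theorem theorem4p1 {E : Type*} [NormedAddCommGroup E] [NormedSpace ℂ E] [CompleteSpace E]
    (n l : ℕ) (hl : 1 ≤ l)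
    (A : E →ₗ.[ℂ] E) (S : ℝ → E →L[ℂ] E)
    (hS : IntegratedGroup.GeneratesIntegratedGroup n A S)
    (M : ℝ) (hM : ∀ t : ℝ, ‖S t‖ ≤ M * (1 + |t| ^ n))
    (lam : IntegratedGroup.NZInt → ℝ) (hmono : StrictMono lam)
    (hpos : ∀ k : IntegratedGroup.NZInt, 0 < k.1 → 0 < lam k)
    (hneg : ∀ k : IntegratedGroup.NZInt, k.1 < 0 → lam k < 0)
    (hspec : IntegratedGroup.spectrum A =
      Set.range fun k : IntegratedGroup.NZInt => Complex.I * (lam k : ℂ))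
    (hsum : Summable fun k : IntegratedGroup.NZInt =>
      1 / (|lam k| ^ l * IntegratedGroup.halfGap lam k ^ n))
    (ε : IntegratedGroup.NZInt → ℝ) (hε : ∀ k, 0 < ε k)
    (hball : ∀ k, Metric.closedBall (Complex.I * (lam k : ℂ)) (ε k) ∩
      IntegratedGroup.spectrum A = {Complex.I * (lam k : ℂ)})
    (x : E) (hx : x ∈ IntegratedGroup.powDomain A (n + l)) :
    HasSum
      (fun k : IntegratedGroup.NZInt =>
        IntegratedGroup.rieszProjection A (Complex.I * (lam k : ℂ)) (ε k) x) x :=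
  hS.hasSum_rieszProjection hl hM hmono hpos hneg hspec hsum hε hball hx
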